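/- Let $\theta\ge 2$, $T>0$ and $a(x)=x^\theta$ on $[0,1]$, so that $\mu_a:=\sup_{0<x\le 1}\frac{x|a'(x)|}{a(x)}=\theta\ge 2$. Consider the problem $$(P)\quad u_{tt}-(x^\theta u_x)_x=0 \text{ in } (0,T)\times(0,1),\quad u(t,1)=0,\quad \lim_{x\downarrow0}x^\theta u_x(t,x)=0,\quad u(0,\cdot)=u_0,\ u_t(0,\cdot)=u_1 .$$ Let $H^1_a(0,1)$ be the space of all $u\in L^2(0,1)$ that are locally absolutely continuous in $(0,1]$ with $\sqrt a\,u'\in L^2(0,1)$ and $u(1)=0$, and let $H^2_a(0,1)$ be the set of $u\in H^1_a(0,1)$ with $au'\in H^1(0,1)$ and $(au')(0)=0$. A mild solution of $(P)$ on $[0,T]$ is a mild solution $U=(u,v)\in C([0,T];H^1_a\times L^2)$ of $U'=AU$, where $A(u,v)=(v,(au')')$ with domain $H^2_a\times H^1_a$; that is, $\int_0^tU\,ds\in D(A)$ and $U(t)=U(0)+A\int_0^tU\,ds$ for all $t\in[0,T]$. Its normal derivative $u_x(\cdot,1)$ is the function $g\in L^2(0,T)$ with $\big(\int_0^tu\,ds\big)_x(1)=\int_0^tg\,ds$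 for all $t\in[0,T]$. Problem $(P)$ is observable in time $T$ (via the normal derivative at $x=1$) if there is $C>0$ such that $\int_0^Tu_x(t,1)^2dt\ge C\,E_u(0)$ for all mild solutions that have such a normal derivative, where $E_u(t)=\frac12\int_0^1(u_t^2+a u_x^2)\,dx$. Set $\varphi(x)=\int_x^1 s^{-\theta/2}ds$, $\psi(y)=e^{-y}$ if $\theta=2$ and $\psi(y)=\big(\frac{2}{2+(\theta-2)y}\big)^{2/(\theta-2)}$ if $\theta>2$, and $$q(y)=\frac{c(\theta)}{[2+(\theta-2)y]^2},\qquad c(\theta)=\frac{\theta(3\theta-4)}4$$ (so $q\equiv\frac14$ if $\theta=2$). Then: 1. On $(0,1]$, $\varphi(x)=\log\frac1x$ if $\theta=2$ and $\varphi(x)=\frac{2(x^{1-\theta/2}-1)}{\theta-2}$ if $\theta>2$; $\varphi:(0,1]\to[0,\infty)$ is a bijection with inverse $\psi$; and $q$ is bounded on $[0,\infty)$. If $f$ is smooth with compact support in $(0,1)$, then $y\mapsto\psi(y)^{\theta/4}f(\psi(y))$ is smooth on $[0,\infty)$ with compact support in $(0,\infty)$. 2. (Liouville transform) Let $u(t,x)=x^{-\theta/4}v(t,\varphi(x))$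 for $t\in[0,T]$, $x\in(0,1]$. Then $u$ is a solution of $(P)$ of class $C^2$ on $[0,T]\times(0,1]$ if and only if $\lim_{x\downarrow0}x^\theta u_x(t,x)=0$ for $0<t<T$ and $v$ is a solution of class $C^2$ on $[0,T]\times[0,\infty)$ of $$(W)\quad v_{tt}-v_{yy}+q(y)v=0\text{ in }(0,T)\times(0,\infty),\quad v(t,0)=0,\quad v(0,\cdot)=v_0,\ v_t(0,\cdot)=v_1$$ with $v_i(y)=\psi(y)^{\theta/4}u_i(\psi(y))$. Moreover, whenever $u(t,1)=0$, one has $u_x(t,1)=-v_y(t,0)$ (one-sided derivatives, one existing if and only if the other does). 3. (Finite speed of propagation) Let $v$ be a $C^2$ solution of $(W)$ with any data $v_0,v_1$, let $t\in[0,T]$ and $y\ge0$. If $v_0$ and $v_1$ vanish on $\{z>0:|z-y|\le t\}$, then $v(t,y)=0$. If $v_0$ and $v_1$ vanish on $(0,T]$, then $v_y(t,0)=0$ for all $t\in[0,T]$. 4. Let $u_0,u_1$ be smooth with compact support in $(0,\psi(T))$. Then $(P)$ has a solution $u$ of class $C^2$ on $[0,T]\times(0,1]$ with $u_x(t,1)=0$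 for all $t\in[0,T]$. Moreover, $(P)$ has a mild solution with these data, every mild solution with these data coincides with $u$, and its normal derivative at $x=1$ is zero on $[0,T]$. One has $\psi(T)<1$, and there are such $u_0,u_1$ that are both not identically zero. 5. Consequently, for every $\theta\ge2$ and every $T>0$, problem $(P)$ is not observable in time $T$ via the normal derivative $u_x(\cdot,1)$. -/

import Mathlib

open Set Filter Topology MeasureTheory
open scoped ContDiff

noncomputable section

namespace DegenerateWave

/-! ### Function spaces on `(0,1)` attached to a coefficient `a` (strongly degenerate case) -/

/-- Lebesgue measure on `(0,1)`. -/
abbrev mu01 : Measure ℝ := volume.restrict (Ioo (0 : ℝ) 1)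

/-- The Hilbert space `L²(0,1)`. -/
abbrev L2 : Type := Lp ℝ 2 mu01

/-- `F` is a representative of an element of `H¹_a(0,1)`: it is in `L²(0,1)`, it is locally
absolutely continuous in `(0,1]`, `√a F' ∈ L²(0,1)`, and `F(1) = 0`. As `a` is strongly degenerate
at `0`, nothing is prescribed at `x = 0`. -/
structure IsH1 (a F : ℝ → ℝ) : Prop where
  memLp : MemLp F 2 mu01
  locAC : ∀ c ∈ Ioo (0 : ℝ) 1, AbsolutelyContinuousOnInterval F c 1
  memLp_deriv : MemLp (fun x => √(a x) * deriv F x) 2 mu01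
  dirichlet : F 1 = 0

/-- `f ∈ H¹_a(0,1)`, and `p ∈ L²(0,1)` is `√a f'`. -/
def MemH1 (a : ℝ → ℝ) (f p : L2) : Prop :=
  ∃ F : ℝ → ℝ, IsH1 a F ∧ f =ᵐ[mu01] F ∧ p =ᵐ[mu01] fun x => √(a x) * deriv F x

/-- `f ∈ H²_a(0,1)`, i.e. `f ∈ H¹_a(0,1)` and `a f' ∈ H¹(0,1)`; moreover `w` is the continuous
representative of `a f'` on `[0,1]`, it satisfies the Neumann condition
`lim_{x → 0} a(x) f'(x) = w(0) = 0`, and `h = (a f')'`. -/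
def MemH2 (a : ℝ → ℝ) (f : L2) (w : ℝ → ℝ) (h : L2) : Prop :=
  ∃ F : ℝ → ℝ, IsH1 a F ∧ f =ᵐ[mu01] F ∧
    AbsolutelyContinuousOnInterval w 0 1 ∧ w =ᵐ[mu01] (fun x => a x * deriv F x) ∧
    w 0 = 0 ∧ h =ᵐ[mu01] deriv w

/-! ### Mild solutions, normal derivative at `x = 1`, observability -/

/-- `(U, V)` is a mild solution on `[0,T]` of `(U, V)' = A (U, V)`, where
`A (u, v) = (v, (a u')')` with domain `H²_a × H¹_a`: it is continuous with values in
`H¹_a × L²`, the integral `∫₀ᵗ (U, V)` lies in the domain of `A`, and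
`(U, V)(t) = (U, V)(0) + A ∫₀ᵗ (U, V)`. (The first component of this identity gives `V = U_t`
and `∫₀ᵗ V = U t - U 0 ∈ H¹_a`.) -/
structure IsMildSolution (a : ℝ → ℝ) (T : ℝ) (U V : ℝ → L2) : Prop where
  continuousOn_fst : ContinuousOn U (Icc 0 T)
  continuousOn_snd : ContinuousOn V (Icc 0 T)
  continuousOn_H1 : ∃ p : ℝ → L2, ContinuousOn p (Icc 0 T) ∧ ∀ t ∈ Icc 0 T, MemH1 a (U t) (p t)
  eq_fst : ∀ t ∈ Icc 0 T, U t = U 0 + ∫ s in (0 : ℝ)..t, V s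
  eq_snd : ∀ t ∈ Icc 0 T, ∃ w : ℝ → ℝ, MemH2 a (∫ s in (0 : ℝ)..t, U s) w (V t - V 0)

/-- The initial position and velocity of `(U, V)` are the functions `u₀` and `u₁`. -/
def HasInitialData (U V : ℝ → L2) (u₀ u₁ : ℝ → ℝ) : Prop :=
  U 0 =ᵐ[mu01] u₀ ∧ V 0 =ᵐ[mu01] u₁

/-- `g ∈ L²(0,T)` is the normal derivative `U_x(·, 1)` of the mild solution `(U, V)`: for all `t`,
the function `∫₀ᵗ U ∈ H²_a`, for which `a (∫₀ᵗ U)_x` is continuous on `[0,1]`, satisfies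
`a(1) (∫₀ᵗ U)_x (1) = a(1) ∫₀ᵗ g`. -/
def IsNormalDerivative (a : ℝ → ℝ) (T : ℝ) (U V : ℝ → L2) (g : ℝ → ℝ) : Prop :=
  MemLp g 2 (volume.restrict (Ioo 0 T)) ∧
    ∀ t ∈ Icc 0 T, ∃ w : ℝ → ℝ, MemH2 a (∫ s in (0 : ℝ)..t, U s) w (V t - V 0) ∧
      w 1 = a 1 * ∫ s in (0 : ℝ)..t, g s

/-- Observability in time `T` via the normal derivative at `x = 1`: for some `C > 0`, every mild
solution satisfies `∫₀ᵀ u_x(t,1)² dt ≥ C E_u(0)`, where `E_u(0) = ½ ∫₀¹ (u_t² + a u_x²) dx` is its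
energy at time `0`. -/
def Observable (a : ℝ → ℝ) (T : ℝ) : Prop :=
  ∃ C : ℝ, 0 < C ∧ ∀ U V : ℝ → L2, IsMildSolution a T U V →
    ∀ p : L2, MemH1 a (U 0) p → ∀ g : ℝ → ℝ, IsNormalDerivative a T U V g →
      C * (1 / 2 * (‖V 0‖ ^ 2 + ‖p‖ ^ 2)) ≤ ∫ t in (0 : ℝ)..T, g t ^ 2

/-! ### The pointwise problems -/

/-- `u` is a `C²` solution of `u_tt - (x^θ u_x)_x = 0` in `(0,T) × (0,1)` with `u(t,1) = 0`,
`lim_{x → 0} x^θ u_x(t,x) = 0`, `u(0,·) = u₀`, `u_t(0,·) = u₁`. -/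
structure IsSolutionDW (θ T : ℝ) (u₀ u₁ : ℝ → ℝ) (u : ℝ → ℝ → ℝ) : Prop where
  contDiffOn : ContDiffOn ℝ 2 (fun z : ℝ × ℝ => u z.1 z.2) (Icc 0 T ×ˢ Ioc 0 1)
  pde : ∀ t ∈ Ioo 0 T, ∀ x ∈ Ioo (0 : ℝ) 1,
    deriv (deriv fun s => u s x) t - deriv (fun z => z ^ θ * deriv (u t) z) x = 0
  dirichlet : ∀ t ∈ Ioo 0 T, u t 1 = 0
  neumann : ∀ t ∈ Ioo 0 T, Tendsto (fun x => x ^ θ * deriv (u t) x) (𝓝[>] 0) (𝓝 0)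
  init : ∀ x ∈ Ioo (0 : ℝ) 1, u 0 x = u₀ x
  init_deriv : ∀ x ∈ Ioo (0 : ℝ) 1, HasDerivWithinAt (fun s => u s x) (u₁ x) (Icc 0 T) 0

/-- `φ(x) = ∫ₓ¹ s^{-θ/2} ds`. -/
def phi (θ x : ℝ) : ℝ := ∫ s in x..1, 1 / s ^ (θ / 2)

/-- The inverse of `φ : (0,1] → [0,∞)`. -/
def psi (θ y : ℝ) : ℝ :=
  if θ = 2 then Real.exp (-y) else (2 / (2 + (θ - 2) * y)) ^ (2 / (θ - 2))

/-- The potential `c(θ) / [2 + (θ - 2) y]²`, `c(θ) = θ (3θ - 4) / 4`; it is `1/4` if `θ = 2`. -/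
def potential (θ y : ℝ) : ℝ := (θ * (3 * θ - 4) / 4) / (2 + (θ - 2) * y) ^ 2

/-- `v` is a `C²` solution of `v_tt - v_yy + q v = 0` in `(0,T) × (0,∞)`, with `q` the above
potential, `v(t,0) = 0`, `v(0,·) = v₀`, `v_t(0,·) = v₁`. -/
structure IsSolutionW (θ T : ℝ) (v₀ v₁ : ℝ → ℝ) (v : ℝ → ℝ → ℝ) : Prop where
  contDiffOn : ContDiffOn ℝ 2 (fun z : ℝ × ℝ => v z.1 z.2) (Icc 0 T ×ˢ Ici 0)
  pde : ∀ t ∈ Ioo 0 T, ∀ y ∈ Ioi (0 : ℝ),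
    deriv (deriv fun s => v s y) t - deriv (deriv (v t)) y + potential θ y * v t y = 0
  dirichlet : ∀ t ∈ Ioo 0 T, v t 0 = 0
  init : ∀ y ∈ Ioi (0 : ℝ), v 0 y = v₀ y
  init_deriv : ∀ y ∈ Ioi (0 : ℝ), HasDerivWithinAt (fun s => v s y) (v₁ y) (Icc 0 T) 0

/-- The transformed initial datum `y ↦ ψ(y)^{θ/4} f(ψ(y))`. -/
def transformData (θ : ℝ) (f : ℝ → ℝ) (y : ℝ) : ℝ := psi θ y ^ (θ / 4) * f (psi θ y)

/-- `f` is a smooth function with compact support contained in the open set `S`. -/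
def IsTestFunction (S : Set ℝ) (f : ℝ → ℝ) : Prop :=
  ContDiff ℝ ∞ f ∧ HasCompactSupport f ∧ tsupport f ⊆ S

end DegenerateWave

end

namespace DegenerateWave

/-! ### Calculus of functions of two real variables -/

/-! For `θ ≥ 2` the travel time `φ(x) = ∫ₓ¹ s^{-θ/2} ds` diverges as `x → 0`, so a signal starting
close enough to the degenerate point cannot reach `x = 1` before time `T`. Observability fails as
soon as such a signal is carried by a genuine mild solution with nonzero energy. The Liouville
substitution `u = x^{-θ/4} v(t, φ(x))` makes this precise (`deriv_rpow_mul_deriv_liouville`,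
`liouville_iff`). It straightens the characteristics to unit speed, moves `x = 0` to infinity and
leaves only a bounded potential. Data supported in `(0, ψ(T))` become data supported in `y > T`. The
weighted energy estimate `IsSolutionW.eq_zero_of_mem_cone` shows that a `C²` solution vanishes where
its backward cone misses the data, whence `v_y(t,0) = 0` on `[0,T]`. Existence is proved on the
whole line (`exists_wave_solution`). In characteristic coordinates the equation becomes a Volterra
equation, solved by a contraction in an exponentially weighted norm; its iterates show that supports
spread at unit speed. For data beyond `y = T` this solution is zero near `y = 0` up to time `T`, so
the boundary condition and the behaviour of the potential for `y ≤ 0` play no role. It is also zero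
for large `y`, so `u` vanishes near `x = 0` and extends by zero to a `C²` function on the plane.
Such a `u` is a mild solution (`exists_mildSolution_of_classical`). Uniqueness among mild solutions
(`IsMildSolution.unique`) follows from an energy identity for the time integral of the difference,
based on Green's formula with a vanishing boundary term at the degenerate end. -/

theorem hasFDerivAt_of_partials {f f₁ f₂ : ℝ → ℝ → ℝ}
    (h₁ : ∀ x y, HasDerivAt (fun s => f s y) (f₁ x y) x)
    (h₂ : ∀ x y, HasDerivAt (f x) (f₂ x y) y)
    (c₁ : Continuous fun z : ℝ × ℝ => f₁ z.1 z.2) (c₂ : Continuous fun z : ℝ × ℝ => f₂ z.1 z.2)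
    (z : ℝ × ℝ) :
    HasFDerivAt (fun z : ℝ × ℝ => f z.1 z.2)
      (f₁ z.1 z.2 • ContinuousLinearMap.fst ℝ ℝ ℝ + f₂ z.1 z.2 • ContinuousLinearMap.snd ℝ ℝ ℝ)
      z := by
  have key := hasStrictFDerivAt_uncurry_coprod (𝕜 := ℝ) (u := z) (f := f)
    (f₁ := fun x y => ContinuousLinearMap.toSpanSingleton ℝ (f₁ x y))
    (f₂ := fun x y => ContinuousLinearMap.toSpanSingleton ℝ (f₂ x y))
    (Eventually.of_forall fun v => (h₁ v.1 v.2).hasFDerivAt)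
    (Eventually.of_forall fun v => (h₂ v.1 v.2).hasFDerivAt)
    ((ContinuousLinearMap.toSpanSingletonCLE (𝕜 := ℝ) (E := ℝ)).continuous.comp c₁).continuousAt
    ((ContinuousLinearMap.toSpanSingletonCLE (𝕜 := ℝ) (E := ℝ)).continuous.comp c₂).continuousAt
  have e : f₁ z.1 z.2 • ContinuousLinearMap.fst ℝ ℝ ℝ + f₂ z.1 z.2 • ContinuousLinearMap.snd ℝ ℝ ℝ
      = (ContinuousLinearMap.toSpanSingleton ℝ (f₁ z.1 z.2)).coprod
        (ContinuousLinearMap.toSpanSingleton ℝ (f₂ z.1 z.2)) := by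
    ext <;> simp
  rw [e]
  exact key.hasFDerivAt

theorem hasDerivAt_comp_of_partials {f f₁ f₂ : ℝ → ℝ → ℝ}
    (h₁ : ∀ x y, HasDerivAt (fun s => f s y) (f₁ x y) x)
    (h₂ : ∀ x y, HasDerivAt (f x) (f₂ x y) y)
    (c₁ : Continuous fun z : ℝ × ℝ => f₁ z.1 z.2) (c₂ : Continuous fun z : ℝ × ℝ => f₂ z.1 z.2)
    {a b : ℝ → ℝ} {a' b' s : ℝ} (ha : HasDerivAt a a' s) (hb : HasDerivAt b b' s) :
    HasDerivAt (fun s => f (a s) (b s)) (f₁ (a s) (b s) * a' + f₂ (a s) (b s) * b') s := by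
  have := (hasFDerivAt_of_partials h₁ h₂ c₁ c₂ (a s, b s)).comp_hasDerivAt s (ha.prodMk hb)
  simpa using! this

theorem contDiff_succ_of_partials {n : ℕ} {f f₁ f₂ : ℝ → ℝ → ℝ}
    (h₁ : ∀ x y, HasDerivAt (fun s => f s y) (f₁ x y) x)
    (h₂ : ∀ x y, HasDerivAt (f x) (f₂ x y) y)
    (c₁ : ContDiff ℝ n fun z : ℝ × ℝ => f₁ z.1 z.2)
    (c₂ : ContDiff ℝ n fun z : ℝ × ℝ => f₂ z.1 z.2) :
    ContDiff ℝ (n + 1 : ℕ) fun z : ℝ × ℝ => f z.1 z.2 := by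
  push_cast
  refine contDiff_succ_iff_hasFDerivAt.2 ⟨_, ?_,
    hasFDerivAt_of_partials h₁ h₂ c₁.continuous c₂.continuous⟩
  exact (c₁.smul contDiff_const).add (c₂.smul contDiff_const)

/-- The partial derivatives of a function of class `C^{n+1}` are of class `C^n`. -/
theorem exists_partials {n : ℕ} {f : ℝ → ℝ → ℝ}
    (hf : ContDiff ℝ (n + 1 : ℕ) fun z : ℝ × ℝ => f z.1 z.2) :
    ∃ f₁ f₂ : ℝ → ℝ → ℝ, (∀ x y, HasDerivAt (fun s => f s y) (f₁ x y) x) ∧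
      (∀ x y, HasDerivAt (f x) (f₂ x y) y) ∧ (ContDiff ℝ n fun z : ℝ × ℝ => f₁ z.1 z.2) ∧
      ContDiff ℝ n fun z : ℝ × ℝ => f₂ z.1 z.2 := by
  push_cast at hf
  obtain ⟨f', hf', h⟩ := contDiff_succ_iff_hasFDerivAt.1 hf
  refine ⟨fun x y => f' (x, y) (1, 0), fun x y => f' (x, y) (0, 1), fun x y => ?_, fun x y => ?_,
    hf'.clm_apply contDiff_const, hf'.clm_apply contDiff_const⟩
  · exact (h (x, y)).comp_hasDerivAt x ((hasDerivAt_id x).prodMk (hasDerivAt_const x y))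
  · exact (h (x, y)).comp_hasDerivAt y ((hasDerivAt_const y x).prodMk (hasDerivAt_id y))

theorem hasDerivAt_integral_param {f f₂ : ℝ → ℝ → ℝ}
    (h₂ : ∀ x y, HasDerivAt (f x) (f₂ x y) y)
    (c : Continuous fun z : ℝ × ℝ => f z.1 z.2) (c₂ : Continuous fun z : ℝ × ℝ => f₂ z.1 z.2)
    (a b y : ℝ) :
    HasDerivAt (fun y => ∫ s in a..b, f s y) (∫ s in a..b, f₂ s y) y := by
  obtain ⟨C, hC⟩ := (isCompact_uIcc.prod (isCompact_closedBall y 1)).exists_bound_of_continuousOn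
    (f := fun z : ℝ × ℝ => f₂ z.1 z.2) (s := uIcc a b ×ˢ Metric.closedBall y 1) c₂.continuousOn
  have cy : ∀ y, Continuous fun s => f s y := fun y =>
    c.comp (by fun_prop : Continuous fun s => (s, y))
  have cy₂ : ∀ y, Continuous fun s => f₂ s y := fun y =>
    c₂.comp (by fun_prop : Continuous fun s => (s, y))
  refine (intervalIntegral.hasDerivAt_integral_of_dominated_loc_of_deriv_le
    (F := fun y s => f s y) (F' := fun y s => f₂ s y) (bound := fun _ => C)
    (Metric.closedBall_mem_nhds y one_pos) (Eventually.of_forall fun y => (cy y).aestronglyMeasurable)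
    ((cy y).intervalIntegrable _ _) (cy₂ y).aestronglyMeasurable ?_
    intervalIntegrable_const ?_).2
  · exact Eventually.of_forall fun s hs y hy => hC (s, y) ⟨uIoc_subset_uIcc hs, hy⟩
  · exact Eventually.of_forall fun s _ y _ => h₂ s y

/-- Induction on `n`: the partial derivative in the upper limit is `f` itself, and the one in the
parameter is an integral of the same kind with `∂₂f`, one order less smooth. -/
theorem contDiff_integral_param (n : ℕ) {f : ℝ → ℝ → ℝ}
    (hf : ContDiff ℝ n fun z : ℝ × ℝ => f z.1 z.2) :
    ContDiff ℝ n fun z : ℝ × ℝ => ∫ s in (0 : ℝ)..z.1, f s z.2 := by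
  induction n generalizing f with
  | zero =>
    simp only [Nat.cast_zero, contDiff_zero] at hf ⊢
    exact intervalIntegral.continuous_parametric_intervalIntegral_of_continuous
      (f := fun (z : ℝ × ℝ) s => f s z.2) (s := fun z => z.1) (a₀ := 0)
      (hf.comp (by fun_prop : Continuous fun p : (ℝ × ℝ) × ℝ => (p.2, p.1.2))) continuous_fst
  | succ n ih =>
    obtain ⟨f₁, f₂, -, h₂, -, c₂⟩ := exists_partials hf
    refine contDiff_succ_of_partials (f := fun x y => ∫ s in (0 : ℝ)..x, f s y) (f₁ := f)
      (f₂ := fun x y => ∫ s in (0 : ℝ)..x, f₂ s y) (fun x y => ?_) (fun x y => ?_)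
      (hf.of_le (by exact_mod_cast n.le_succ)) (ih c₂)
    · have c : Continuous fun s => f s y :=
        hf.continuous.comp (by fun_prop : Continuous fun s => (s, y))
      exact intervalIntegral.integral_hasDerivAt_right (c.intervalIntegrable _ _)
        (c.stronglyMeasurableAtFilter _ _) c.continuousAt
    · exact hasDerivAt_integral_param h₂ hf.continuous c₂.continuous _ _ _

theorem contDiff_integral_Ioc_fst (n : ℕ) {f : ℝ → ℝ → ℝ}
    (hf : ContDiff ℝ n fun z : ℝ × ℝ => f z.1 z.2) :
    ContDiff ℝ n fun z : ℝ × ℝ => ∫ s in z.2..z.1, f s z.2 := by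
  have h := contDiff_integral_param n hf
  have h' : ContDiff ℝ n fun z : ℝ × ℝ => ∫ s in (0 : ℝ)..z.2, f s z.2 :=
    h.comp (contDiff_snd.prodMk contDiff_snd : ContDiff ℝ n fun z : ℝ × ℝ => (z.2, z.2))
  convert h.sub h' using 2 with z
  have c : Continuous fun s => f s z.2 :=
    hf.continuous.comp (by fun_prop : Continuous fun s => (s, z.2))
  exact (intervalIntegral.integral_interval_sub_left (c.intervalIntegrable _ _)
    (c.intervalIntegrable _ _)).symm

theorem contDiff_integral_Ioc_snd (n : ℕ) {f : ℝ → ℝ → ℝ}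
    (hf : ContDiff ℝ n fun z : ℝ × ℝ => f z.1 z.2) :
    ContDiff ℝ n fun z : ℝ × ℝ => ∫ r in z.2..z.1, f z.1 r := by
  have hs : ContDiff ℝ n fun z : ℝ × ℝ => f z.2 z.1 :=
    hf.comp (contDiff_snd.prodMk contDiff_fst : ContDiff ℝ n fun z : ℝ × ℝ => (z.2, z.1))
  have h := (contDiff_integral_Ioc_fst n (f := fun r s => f s r) hs).comp
    (contDiff_snd.prodMk contDiff_fst : ContDiff ℝ n fun z : ℝ × ℝ => (z.2, z.1))
  convert h.neg using 2 with z
  exact intervalIntegral.integral_symm _ _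

/-- Chain rule for `(p, q) ↦ ∫_p^b f(s, q) ds` along the diagonal `p = q = y`. -/
theorem hasDerivAt_integral_diag {f f₂ : ℝ → ℝ → ℝ}
    (h₂ : ∀ x y, HasDerivAt (f x) (f₂ x y) y)
    (c : Continuous fun z : ℝ × ℝ => f z.1 z.2) (c₂ : Continuous fun z : ℝ × ℝ => f₂ z.1 z.2)
    (b y : ℝ) :
    HasDerivAt (fun y => ∫ s in y..b, f s y) (-f y y + ∫ s in y..b, f₂ s y) y := by
  have cy : ∀ y, Continuous fun s => f s y :=
    fun y =>
    c.comp (by fun_prop : Continuous fun s => (s, y))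
  have cc : Continuous fun z : ℝ × ℝ => ∫ s in z.1..b, f₂ s z.2 := by
    have e : (fun z : ℝ × ℝ => ∫ s in z.1..b, f₂ s z.2) = fun z => -∫ s in b..z.1, f₂ s z.2 :=
      funext fun z => intervalIntegral.integral_symm _ _
    rw [e]
    exact (intervalIntegral.continuous_parametric_intervalIntegral_of_continuous
      (f := fun (z : ℝ × ℝ) s => f₂ s z.2) (s := fun z => z.1) (a₀ := b)
      (c₂.comp (by fun_prop : Continuous fun p : (ℝ × ℝ) × ℝ => (p.2, p.1.2))) continuous_fst).neg
  have := hasDerivAt_comp_of_partials (f := fun p q => ∫ s in p..b, f s q)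
    (f₁ := fun p q => -f p q) (f₂ := fun p q => ∫ s in p..b, f₂ s q)
    (fun p q => intervalIntegral.integral_hasDerivAt_left ((cy q).intervalIntegrable _ _)
      ((cy q).stronglyMeasurableAtFilter _ _) (cy q).continuousAt)
    (fun p q => hasDerivAt_integral_param h₂ c c₂ p b q) c.neg cc
    (hasDerivAt_id y) (hasDerivAt_id y)
  simpa using this

/-! ### The wave equation on the line with a bounded potential -/

/-- `∫_y^x ∫_y^s F(s,r) dr ds`, the solution of `w_{xy} = -F` with vanishing Cauchy data on the
diagonal. -/
noncomputable def triangleIntegral (F : ℝ → ℝ → ℝ) (x y : ℝ) : ℝ := ∫ s in y..x, ∫ r in y..s, F s r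

theorem contDiff_triangleIntegral (n : ℕ) {F : ℝ → ℝ → ℝ}
    (hF : ContDiff ℝ n fun z : ℝ × ℝ => F z.1 z.2) :
    ContDiff ℝ n fun z : ℝ × ℝ => triangleIntegral F z.1 z.2 :=
  contDiff_integral_Ioc_fst n (f := fun s y => ∫ r in y..s, F s r) (contDiff_integral_Ioc_snd n hF)

theorem continuous_uncurry_left {F : ℝ → ℝ → ℝ} (hF : Continuous fun z : ℝ × ℝ => F z.1 z.2)
    (y : ℝ) : Continuous fun s => F s y :=
  hF.comp (by fun_prop : Continuous fun s => (s, y))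

theorem continuous_uncurry_right {F : ℝ → ℝ → ℝ} (hF : Continuous fun z : ℝ × ℝ => F z.1 z.2)
    (x : ℝ) : Continuous (F x) :=
  hF.comp (by fun_prop : Continuous fun s => (x, s))

theorem hasDerivAt_integral_upper {g : ℝ → ℝ} (hg : Continuous g) (a x : ℝ) :
    HasDerivAt (fun x => ∫ s in a..x, g s) (g x) x :=
  intervalIntegral.integral_hasDerivAt_right (hg.intervalIntegrable _ _)
    (hg.stronglyMeasurableAtFilter _ _) hg.continuousAt

theorem hasDerivAt_integral_lower {g : ℝ → ℝ} (hg : Continuous g) (x b : ℝ) :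
    HasDerivAt (fun x => ∫ s in x..b, g s) (-g x) x :=
  intervalIntegral.integral_hasDerivAt_left (hg.intervalIntegrable _ _)
    (hg.stronglyMeasurableAtFilter _ _) hg.continuousAt

theorem continuous_integral_Ioc_snd {F : ℝ → ℝ → ℝ} (hF : Continuous fun z : ℝ × ℝ => F z.1 z.2) :
    Continuous fun z : ℝ × ℝ => ∫ r in z.2..z.1, F z.1 r := by
  have := contDiff_integral_Ioc_snd 0 (f := F) (by simpa using hF)
  simpa using this

theorem hasDerivAt_triangleIntegral_fst {F : ℝ → ℝ → ℝ}
    (hF : Continuous fun z : ℝ × ℝ => F z.1 z.2) (x y : ℝ) :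
    HasDerivAt (fun x => triangleIntegral F x y) (∫ r in y..x, F x r) x :=
  hasDerivAt_integral_upper (continuous_uncurry_left (F := fun s y => ∫ r in y..s, F s r)
    (continuous_integral_Ioc_snd hF) y) y x

theorem hasDerivAt_triangleIntegral_snd {F : ℝ → ℝ → ℝ}
    (hF : Continuous fun z : ℝ × ℝ => F z.1 z.2) (x y : ℝ) :
    HasDerivAt (triangleIntegral F x) (-∫ s in y..x, F s y) y := by
  have := hasDerivAt_integral_diag (f := fun s y => ∫ r in y..s, F s r) (f₂ := fun s y => -F s y)
    (fun s y => hasDerivAt_integral_lower (continuous_uncurry_right hF s) y s)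
    (continuous_integral_Ioc_snd hF) hF.neg x y
  simpa [triangleIntegral] using! this

/-- Both first partial derivatives are single integrals of `F`, hence as smooth as `F`. This gain of
one order lifts the merely continuous Volterra solution to class `C²`. -/
theorem contDiff_succ_triangleIntegral {n : ℕ} {F : ℝ → ℝ → ℝ}
    (hF : ContDiff ℝ n fun z : ℝ × ℝ => F z.1 z.2) :
    ContDiff ℝ (n + 1 : ℕ) fun z : ℝ × ℝ => triangleIntegral F z.1 z.2 :=
  contDiff_succ_of_partials (hasDerivAt_triangleIntegral_fst hF.continuous)
    (hasDerivAt_triangleIntegral_snd hF.continuous) (contDiff_integral_Ioc_snd n hF)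
    (contDiff_integral_Ioc_fst n hF).neg

/-! ### Exponentially weighted bounds for the iterated integral -/

/-- Integrating the weight `e^{l|x-a|}` away from its centre gains a factor `1/l`; a large `l` will
turn the Volterra operator into a contraction. -/
theorem abs_integral_le_exp_left {g : ℝ → ℝ} {C l a b : ℝ} (hC : 0 ≤ C) (hl : 0 < l)
    (h : ∀ x ∈ uIcc a b, |g x| ≤ C * Real.exp (l * |x - a|)) :
    |∫ x in a..b, g x| ≤ C / l * Real.exp (l * |b - a|) := by
  have h₁ : |∫ x in a..b, g x| ≤ |∫ x in a..b, C * Real.exp (l * |x - a|)| := by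
    have hi : IntervalIntegrable (fun x => C * Real.exp (l * |x - a|)) volume a b :=
      (by fun_prop : Continuous fun x => C * Real.exp (l * |x - a|)).intervalIntegrable _ _
    refine intervalIntegral.norm_integral_le_abs_of_norm_le (f := g) ?_ hi
    filter_upwards [ae_restrict_mem measurableSet_uIoc] with x hx
    exact h x (uIoc_subset_uIcc hx)
  -- `σ` is the direction of integration; it removes the absolute value and gives an explicit
  -- antiderivative for both orders of the endpoints.
  obtain ⟨σ, hσ, hab⟩ : ∃ σ : ℝ, (σ = 1 ∨ σ = -1) ∧ ∀ x ∈ uIcc a b, |x - a| = σ * (x - a) := by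
    rcases le_total a b with hab | hab
    · refine ⟨1, Or.inl rfl, fun x hx => ?_⟩
      rw [uIcc_of_le hab] at hx
      rw [abs_of_nonneg (sub_nonneg.2 hx.1), one_mul]
    · refine ⟨-1, Or.inr rfl, fun x hx => ?_⟩
      rw [uIcc_of_ge hab] at hx
      rw [abs_of_nonpos (sub_nonpos.2 hx.2), neg_one_mul]
  have hσ0 : σ ≠ 0 := by rcases hσ with rfl | rfl <;> norm_num
  have hσ1 : |σ| = 1 := by rcases hσ with rfl | rfl <;> norm_num
  have h₂ : ∫ x in a..b, C * Real.exp (l * |x - a|) =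
      C / (l * σ) * (Real.exp (l * |b - a|) - 1) := by
    have hd : ∀ x ∈ uIcc a b, HasDerivAt (fun x => C / (l * σ) * Real.exp (l * (σ * (x - a))))
        (C * Real.exp (l * |x - a|)) x := by
      intro x hx
      have := (((((hasDerivAt_id x).sub_const a).const_mul σ).const_mul l).exp).const_mul
        (C / (l * σ))
      refine this.congr_deriv ?_
      rw [hab x hx]
      simp only [id]
      field_simp
    rw [intervalIntegral.integral_eq_sub_of_hasDerivAt hd
      ((by fun_prop : Continuous fun x => C * Real.exp (l * |x - a|)).intervalIntegrable _ _),
      hab b right_mem_uIcc]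
    simp
    ring
  have h₃ : 1 ≤ Real.exp (l * |b - a|) := Real.one_le_exp (by positivity)
  refine h₁.trans ?_
  rw [h₂, abs_mul, abs_div, abs_mul, hσ1, abs_of_nonneg hC, abs_of_pos hl, mul_one,
    abs_of_nonneg (by linarith)]
  have : 0 ≤ C / l := by positivity
  nlinarith

theorem abs_integral_le_exp_right {g : ℝ → ℝ} {C l a b : ℝ} (hC : 0 ≤ C) (hl : 0 < l)
    (h : ∀ x ∈ uIcc a b, |g x| ≤ C * Real.exp (l * |b - x|)) :
    |∫ x in a..b, g x| ≤ C / l * Real.exp (l * |b - a|) := by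
  rw [intervalIntegral.integral_symm, abs_neg, abs_sub_comm b a]
  refine abs_integral_le_exp_left hC hl fun x hx => ?_
  rw [abs_sub_comm]
  exact h x (uIcc_comm a b ▸ hx)

/-- The inner weight is centred at the upper limit `s` and leaves `e^{l|s-y|}`, which is centred at
the lower limit of the outer integral, so each integration gains `1/l`. -/
theorem abs_triangleIntegral_le {F : ℝ → ℝ → ℝ} {C l : ℝ} (hC : 0 ≤ C) (hl : 0 < l)
    (h : ∀ s r, |F s r| ≤ C * Real.exp (l * |s - r|)) (x y : ℝ) :
    |triangleIntegral F x y| ≤ C / l / l * Real.exp (l * |x - y|) :=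
  abs_integral_le_exp_left (by positivity) hl fun s _ =>
    abs_integral_le_exp_right hC hl fun r _ => h s r

theorem triangleIntegral_eq_zero {F : ℝ → ℝ → ℝ} {x y : ℝ}
    (h : ∀ s ∈ uIcc y x, ∀ r ∈ uIcc y s, F s r = 0) : triangleIntegral F x y = 0 := by
  have h₁ : EqOn (fun s => ∫ r in y..s, F s r) (fun _ => 0) (uIcc y x) := fun s hs => by
    have h₂ : EqOn (F s) (fun _ => 0) (uIcc y s) := fun r hr => h s hs r hr
    simp [intervalIntegral.integral_congr h₂]
  simp [triangleIntegral, intervalIntegral.integral_congr h₁]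

theorem triangleIntegral_sub {F G : ℝ → ℝ → ℝ} (hF : Continuous fun z : ℝ × ℝ => F z.1 z.2)
    (hG : Continuous fun z : ℝ × ℝ => G z.1 z.2) (x y : ℝ) :
    triangleIntegral (fun s r => F s r - G s r) x y =
      triangleIntegral F x y - triangleIntegral G x y := by
  unfold triangleIntegral
  rw [← intervalIntegral.integral_sub]
  · congr 1 with s
    exact intervalIntegral.integral_sub ((continuous_uncurry_right hF s).intervalIntegrable _ _)
      ((continuous_uncurry_right hG s).intervalIntegrable _ _)
  · exact (continuous_uncurry_left (F := fun s y => ∫ r in y..s, F s r)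
      (continuous_integral_Ioc_snd hF) y).intervalIntegrable _ _
  · exact (continuous_uncurry_left (F := fun s y => ∫ r in y..s, G s r)
      (continuous_integral_Ioc_snd hG) y).intervalIntegrable _ _

open BoundedContinuousFunction in
/-- The Volterra equation `w = f + ∫∫ q w` is solvable, and its solution vanishes on every set
of dependence on which `f` does. -/
theorem exists_volterra_solution {q f : ℝ → ℝ → ℝ} {M N : ℝ} {S : Set (ℝ × ℝ)}
    (cq : Continuous fun z : ℝ × ℝ => q z.1 z.2) (hq : ∀ x y, |q x y| ≤ M)
    (cf : Continuous fun z : ℝ × ℝ => f z.1 z.2) (hN : 0 ≤ N)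
    (hf : ∀ x y, |f x y| ≤ N * Real.exp |x - y|)
    (hS : ∀ x y, (x, y) ∈ S → ∀ s ∈ uIcc y x, ∀ r ∈ uIcc y s, (s, r) ∈ S)
    (hfS : ∀ x y, (x, y) ∈ S → f x y = 0) :
    ∃ w : ℝ → ℝ → ℝ, (Continuous fun z : ℝ × ℝ => w z.1 z.2) ∧
      (∀ x y, w x y = f x y + triangleIntegral (fun s r => q s r * w s r) x y) ∧
      ∀ x y, (x, y) ∈ S → w x y = 0 := by
  have hM : 0 ≤ M := (abs_nonneg _).trans (hq 0 0)
  -- This `l` satisfies `M / l² ≤ 1/2`, the contraction constant, and `l ≥ 1`, so the weight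
  -- dominates the growth `e^{|x-y|}` allowed for `f`.
  set l : ℝ := M + 1 with hl
  have hl0 : 0 < l := by positivity
  -- The unknown is written as weight times a bounded function `z`, so that the fixed point is
  -- sought in a complete space with the sup norm.
  let W : (ℝ × ℝ →ᵇ ℝ) → ℝ → ℝ → ℝ := fun z s r => Real.exp (l * |s - r|) * z (s, r)
  have cW : ∀ z, Continuous fun p : ℝ × ℝ => W z p.1 p.2 := fun z => by
    have := z.continuous
    fun_prop
  have cqW : ∀ z, Continuous fun p : ℝ × ℝ => q p.1 p.2 * W z p.1 p.2 := fun z => cq.mul (cW z)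
  have cI : ∀ z, Continuous fun p : ℝ × ℝ =>
      triangleIntegral (fun s r => q s r * W z s r) p.1 p.2 := fun z => by
    have := contDiff_triangleIntegral 0 (F := fun s r => q s r * W z s r) (by simpa using cqW z)
    simpa using this
  have bI : ∀ (G : ℝ → ℝ → ℝ) (C : ℝ), 0 ≤ C → (∀ s r, |G s r| ≤ C * Real.exp (l * |s - r|)) →
      ∀ x y, |triangleIntegral G x y| ≤ C / l / l * Real.exp (l * |x - y|) :=
    fun G C hC hG => abs_triangleIntegral_le hC hl0 hG
  have bqW : ∀ (z : ℝ × ℝ →ᵇ ℝ) s r, |q s r * W z s r| ≤ M * ‖z‖ * Real.exp (l * |s - r|) := by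
    intro z s r
    rw [abs_mul, abs_mul, Real.abs_exp, mul_assoc, mul_comm ‖z‖]
    exact mul_le_mul (hq s r) (mul_le_mul_of_nonneg_left (z.norm_coe_le_norm _)
      (Real.exp_pos _).le) (by positivity) hM
  have hexp : ∀ p : ℝ × ℝ, Real.exp (-(l * |p.1 - p.2|)) * Real.exp (l * |p.1 - p.2|) = 1 :=
    fun p => by rw [← Real.exp_add]; simp
  have hscale : ∀ (p : ℝ × ℝ) (A C : ℝ), |A| ≤ C * Real.exp (l * |p.1 - p.2|) →
      ‖Real.exp (-(l * |p.1 - p.2|)) * A‖ ≤ C := by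
    intro p A C h
    rw [Real.norm_eq_abs, abs_mul, Real.abs_exp]
    calc _ ≤ Real.exp (-(l * |p.1 - p.2|)) * (C * Real.exp (l * |p.1 - p.2|)) := by gcongr
      _ = C := by rw [mul_left_comm, hexp, mul_one]
  let Φ : (ℝ × ℝ →ᵇ ℝ) → (ℝ × ℝ →ᵇ ℝ) := fun z => BoundedContinuousFunction.ofNormedAddCommGroup
    (fun p => Real.exp (-(l * |p.1 - p.2|)) *
      (f p.1 p.2 + triangleIntegral (fun s r => q s r * W z s r) p.1 p.2))
    (by have := cI z; fun_prop) (N + M * ‖z‖ / l / l) (by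
      intro p
      refine hscale p _ _ ((abs_add_le _ _).trans ?_)
      rw [add_mul]
      refine add_le_add ((hf p.1 p.2).trans ?_) (bI _ _ (by positivity) (bqW z) _ _)
      gcongr
      nlinarith [abs_nonneg (p.1 - p.2)])
  have hΦ : ∀ z p, Φ z p = Real.exp (-(l * |p.1 - p.2|)) *
      (f p.1 p.2 + triangleIntegral (fun s r => q s r * W z s r) p.1 p.2) := fun z p => rfl
  have hcontr : ContractingWith (1 / 2) Φ := by
    refine ⟨by rw [← NNReal.coe_lt_coe]; norm_num, LipschitzWith.of_dist_le_mul fun z z' => ?_⟩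
    refine (BoundedContinuousFunction.dist_le (by positivity)).2 fun p => ?_
    rw [dist_eq_norm_sub, dist_eq_norm_sub, hΦ, hΦ, ← mul_sub]
    refine hscale p _ _ ?_
    rw [add_sub_add_left_eq_sub, ← triangleIntegral_sub (cqW z) (cqW z')]
    refine (bI _ (M * ‖z - z'‖) (by positivity) (fun s r => ?_) _ _).trans ?_
    · convert bqW (z - z') s r using 2
      simp only [W, BoundedContinuousFunction.coe_sub, Pi.sub_apply]
      ring
    · refine mul_le_mul_of_nonneg_right ?_ (Real.exp_pos _).le
      rw [div_div, div_le_iff₀ (by positivity)]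
      have : 2 * M ≤ l * l := by nlinarith [sq_nonneg (M - 1)]
      have := mul_le_mul_of_nonneg_right this (norm_nonneg (z - z'))
      norm_num
      linarith
  have : Nonempty (ℝ × ℝ →ᵇ ℝ) := ⟨0⟩
  set z := hcontr.fixedPoint Φ with hz
  have hfix : Φ z = z := hcontr.fixedPoint_isFixedPt
  have hw : ∀ x y, W z x y = f x y + triangleIntegral (fun s r => q s r * W z s r) x y := by
    intro x y
    have h₁ : W z x y = Real.exp (l * |x - y|) * Φ z (x, y) := by rw [hfix]
    rw [h₁, hΦ, ← mul_assoc, mul_comm (Real.exp _), hexp (x, y), one_mul]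
  -- The functions vanishing on `S` form a closed set that contains `0` and is invariant under `Φ`;
  -- the fixed point is a limit of iterates started at `0`.
  have hzero : z ∈ {z : ℝ × ℝ →ᵇ ℝ | ∀ p ∈ S, z p = 0} := by
    have hcl : IsClosed {z : ℝ × ℝ →ᵇ ℝ | ∀ p ∈ S, z p = 0} := by
      simp only [ofPred_forall]
      exact isClosed_iInter fun p => isClosed_iInter fun _ =>
        isClosed_eq (continuous_eval_const p) continuous_const
    refine hcl.mem_of_tendsto (hcontr.tendsto_iterate_fixedPoint 0)
      (Eventually.of_forall fun n => ?_)
    induction n with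
    | zero => intro p _; rfl
    | succ n ih =>
      rw [Function.iterate_succ_apply']
      intro p hp
      rw [hΦ, hfS p.1 p.2 hp, triangleIntegral_eq_zero fun s hs r hr => ?_]
      · simp
      · simp [W, ih (s, r) (hS p.1 p.2 hp s hs r hr)]
  exact ⟨W z, cW z, hw, fun x y h => by simp [W, hzero (x, y) h]⟩

/-- The integration triangle of `(x, y)` only involves points between `x` and `y`; hence conditions
of the form `max < A` or `B < min` define admissible sets of dependence. -/
theorem min_le_min_and_max_le_max_of_mem_uIcc {x y s r : ℝ} (hs : s ∈ uIcc y x) (hr : r ∈ uIcc y s) :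
    min x y ≤ min s r ∧ max s r ≤ max x y := by
  rw [mem_uIcc] at hs hr
  constructor
  · refine le_min ?_ ?_ <;> grind
  · refine max_le ?_ ?_ <;> grind

/-- Global solvability of `v_tt - v_yy + Q v = 0` on the line for compactly supported data, with
finite speed of propagation. -/
theorem exists_wave_solution {Q v₀ v₁ : ℝ → ℝ} {M A B : ℝ} (hQ : ContDiff ℝ 2 Q)
    (hM : ∀ y, |Q y| ≤ M) (h₀ : ContDiff ℝ 2 v₀) (h₁ : ContDiff ℝ 2 v₁)
    (hsupp : ∀ y, y ∉ Icc A B → v₀ y = 0 ∧ v₁ y = 0) :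
    ∃ v : ℝ → ℝ → ℝ, (ContDiff ℝ 2 fun z : ℝ × ℝ => v z.1 z.2) ∧
      (∀ t y, deriv (deriv fun s => v s y) t - deriv (deriv (v t)) y + Q y * v t y = 0) ∧
      (∀ y, v 0 y = v₀ y) ∧ (∀ y, HasDerivAt (fun s => v s y) (v₁ y) 0) ∧
      ∀ t y, y + |t| < A ∨ B < y - |t| → v t y = 0 := by
  have hc₁ : Continuous v₁ := h₁.continuous
  have hcs : ∀ g : ℝ → ℝ, Continuous g → (∀ y, y ∉ Icc A B → g y = 0) → ∃ C, 0 ≤ C ∧ ∀ y, |g y| ≤ C := by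
    intro g hg hz
    obtain ⟨C, hC⟩ := isCompact_Icc.exists_bound_of_continuousOn (s := Icc A B) hg.continuousOn
    refine ⟨max C 0, le_max_right _ _, fun y => ?_⟩
    by_cases hy : y ∈ Icc A B
    · exact (hC y hy).trans (le_max_left _ _)
    · simp [hz y hy]
  obtain ⟨N₀, hN₀, hb₀⟩ := hcs v₀ h₀.continuous fun y hy => (hsupp y hy).1
  obtain ⟨N₁, hN₁, hb₁⟩ := hcs v₁ hc₁ fun y hy => (hsupp y hy).2
  -- d'Alembert's formula for the free equation, in the characteristic coordinates that replace `(t,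
  -- y)` by `(y + t, y - t)`.
  let f : ℝ → ℝ → ℝ := fun x y => (v₀ x + v₀ y) / 2 + (∫ s in y..x, v₁ s) / 2
  have hP : ContDiff ℝ (2 : ℕ) fun z : ℝ × ℝ => ∫ s in z.2..z.1, v₁ s :=
    contDiff_integral_Ioc_fst 2 (f := fun s _ => v₁ s) (h₁.comp contDiff_fst)
  have hf2 : ContDiff ℝ (2 : ℕ) fun z : ℝ × ℝ => f z.1 z.2 :=
    (((h₀.comp contDiff_fst).add (h₀.comp contDiff_snd)).div_const 2).add (hP.div_const 2)
  -- For `v(t,y) = w(y+t, y-t)` one has `v_tt - v_yy = -4 w_{xy}`, so the equation reads `w_{xy} =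
  -- (Q/4) w`. The sign is that of `triangleIntegral`, whose mixed derivative is `-F`.
  let q : ℝ → ℝ → ℝ := fun x y => -(Q ((x + y) / 2) / 4)
  have hq2 : ContDiff ℝ (2 : ℕ) fun z : ℝ × ℝ => q z.1 z.2 :=
    ((hQ.comp ((contDiff_fst.add contDiff_snd).div_const 2)).div_const 4).neg
  -- Points whose interval of dependence lies entirely to the left of `A` or to the right of `B`,
  -- where the data vanish.
  let S : Set (ℝ × ℝ) := {p | max p.1 p.2 < A ∨ B < min p.1 p.2}
  have hq : ∀ x y, |q x y| ≤ M / 4 := fun x y => by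
    simp only [q, abs_neg, abs_div]
    norm_num
    linarith [hM ((x + y) / 2)]
  have hfb : ∀ x y, |f x y| ≤ (N₀ + N₁) * Real.exp |x - y| := by
    intro x y
    have e₁ : |∫ s in y..x, v₁ s| ≤ N₁ * |x - y| :=
      intervalIntegral.norm_integral_le_of_norm_le_const (f := v₁) fun s _ => hb₁ s
    have e₂ := Real.add_one_le_exp |x - y|
    have e₃ : |f x y| ≤ N₀ + N₁ * |x - y| := by
      refine (abs_add_le _ _).trans ?_
      rw [abs_div, abs_div, abs_two]
      have := abs_add_le (v₀ x) (v₀ y)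
      have := mul_nonneg hN₁ (abs_nonneg (x - y))
      linarith [hb₀ x, hb₀ y]
    have e₄ : 1 ≤ Real.exp |x - y| := Real.one_le_exp (abs_nonneg _)
    nlinarith
  have hSS : ∀ x y, (x, y) ∈ S → ∀ s ∈ uIcc y x, ∀ r ∈ uIcc y s, (s, r) ∈ S := by
    intro x y h s hs r hr
    obtain ⟨h₁, h₂⟩ := min_le_min_and_max_le_max_of_mem_uIcc hs hr
    exact h.imp (fun h => h₂.trans_lt h) fun h => h.trans_le h₁
  have hfS : ∀ x y, (x, y) ∈ S → f x y = 0 := by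
    intro x y h
    have hz : ∀ s ∈ uIcc y x, s ∉ Icc A B := by
      intro s hs hAB
      rw [mem_uIcc] at hs
      rcases h with h | h
      · have := max_lt_iff.1 h
        simp only at this
        rcases hs with hs | hs <;> linarith [hAB.1, hs.2]
      · have := lt_min_iff.1 h
        simp only at this
        rcases hs with hs | hs <;> linarith [hAB.2, hs.1]
    have e : EqOn v₁ (fun _ => 0) (uIcc y x) := fun s hs => (hsupp s (hz s hs)).2
    simp [f, (hsupp x (hz x right_mem_uIcc)).1, (hsupp y (hz y left_mem_uIcc)).1,
      intervalIntegral.integral_congr e]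
  obtain ⟨w, cw, hw, hwS⟩ := exists_volterra_solution (S := S) hq2.continuous hq
    hf2.continuous (add_nonneg hN₀ hN₁) hfb hSS hfS
  set F : ℝ → ℝ → ℝ := fun s r => q s r * w s r with hF
  have hweq : (fun z : ℝ × ℝ => w z.1 z.2) = fun z => f z.1 z.2 + triangleIntegral F z.1 z.2 :=
    funext fun z => hw z.1 z.2
  have cF : Continuous fun z : ℝ × ℝ => F z.1 z.2 := hq2.continuous.mul cw
  -- Bootstrap through the integral equation: `w` continuous gives `w` of class `C¹`, hence `F` of
  -- class `C¹`, hence `w` of class `C²`.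
  have hw1 : ContDiff ℝ (1 : ℕ) fun z : ℝ × ℝ => w z.1 z.2 := by
    rw [hweq]
    exact (hf2.of_le (by norm_num)).add
      (contDiff_succ_triangleIntegral (n := 0) (by simpa using cF))
  have hF1 : ContDiff ℝ (1 : ℕ) fun z : ℝ × ℝ => F z.1 z.2 := (hq2.of_le (by norm_num)).mul hw1
  have hw2 : ContDiff ℝ (2 : ℕ) fun z : ℝ × ℝ => w z.1 z.2 := by
    rw [hweq]
    exact hf2.add (contDiff_succ_triangleIntegral (n := 1) hF1)
  have h₀d : Differentiable ℝ v₀ := h₀.differentiable (by norm_num)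
  have h₀d' : ContDiff ℝ (1 : ℕ) (deriv v₀) := (contDiff_succ_iff_deriv (n := 1)).1 h₀ |>.2.2
  -- first derivatives in characteristic coordinates
  let w₁ : ℝ → ℝ → ℝ := fun x y => (deriv v₀ x + v₁ x) / 2 + ∫ r in y..x, F x r
  let w₂ : ℝ → ℝ → ℝ := fun x y => (deriv v₀ y - v₁ y) / 2 - ∫ s in y..x, F s y
  have dw₁ : ∀ x y, HasDerivAt (fun s => w s y) (w₁ x y) x := by
    intro x y
    have e : (fun s => w s y) = fun s => f s y + triangleIntegral F s y := funext fun s => hw s y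
    rw [e]
    refine HasDerivAt.add ?_ (hasDerivAt_triangleIntegral_fst cF x y)
    exact ((((h₀d x).hasDerivAt.add_const (v₀ y)).div_const 2).add
      ((hasDerivAt_integral_upper hc₁ y x).div_const 2)).congr_deriv (by ring)
  have dw₂ : ∀ x y, HasDerivAt (w x) (w₂ x y) y := by
    intro x y
    have e : w x = fun s => f x s + triangleIntegral F x s := funext fun s => hw x s
    rw [e]
    refine HasDerivAt.add ?_ (hasDerivAt_triangleIntegral_snd cF x y)
    exact ((((h₀d y).hasDerivAt.const_add (v₀ x)).div_const 2).add
      ((hasDerivAt_integral_lower hc₁ y x).div_const 2)).congr_deriv (by ring)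
  have h₁1 : ContDiff ℝ (1 : ℕ) v₁ := h₁.of_le (by norm_num)
  have cw₁ : ContDiff ℝ (1 : ℕ) fun z : ℝ × ℝ => w₁ z.1 z.2 :=
    (((h₀d'.add h₁1).comp contDiff_fst).div_const 2).add (contDiff_integral_Ioc_snd 1 hF1)
  have cw₂ : ContDiff ℝ (1 : ℕ) fun z : ℝ × ℝ => w₂ z.1 z.2 :=
    (((h₀d'.sub h₁1).comp contDiff_snd).div_const 2).sub (contDiff_integral_Ioc_fst 1 hF1)
  obtain ⟨w₁₁, w₁₂', d₁₁, -, c₁₁, -⟩ := exists_partials (n := 0) cw₁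
  obtain ⟨w₂₁', w₂₂, -, d₂₂, -, c₂₂⟩ := exists_partials (n := 0) cw₂
  -- Both mixed derivatives are read off the explicit formulas as `-F`; only the pure second
  -- derivatives stay abstract, and these cancel in `v_tt - v_yy`.
  have d₁₂ : ∀ x y, HasDerivAt (w₁ x) (-F x y) y := fun x y =>
    (hasDerivAt_integral_lower (continuous_uncurry_right cF x) y x).const_add _
  have d₂₁ : ∀ x y, HasDerivAt (fun s => w₂ s y) (-F x y) x := fun x y =>
    (hasDerivAt_integral_upper (continuous_uncurry_left cF y) y x).const_sub _
  have dplus : ∀ t y : ℝ, HasDerivAt (fun s => y + s) 1 t := fun t y =>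
    (hasDerivAt_id t).const_add y
  have dminus : ∀ t y : ℝ, HasDerivAt (fun s => y - s) (-1) t := fun t y =>
    (hasDerivAt_id t).const_sub y
  have dplus' : ∀ t y : ℝ, HasDerivAt (fun s => s + t) 1 y := fun t y =>
    (hasDerivAt_id y).add_const t
  have dminus' : ∀ t y : ℝ, HasDerivAt (fun s => s - t) 1 y := fun t y =>
    (hasDerivAt_id y).sub_const t
  have vt : ∀ t y, HasDerivAt (fun s => w (y + s) (y - s))
      (w₁ (y + t) (y - t) - w₂ (y + t) (y - t)) t := fun t y =>
    (hasDerivAt_comp_of_partials dw₁ dw₂ cw₁.continuous cw₂.continuous (dplus t y)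
      (dminus t y)).congr_deriv (by ring)
  have vy : ∀ t y, HasDerivAt (fun s => w (s + t) (s - t))
      (w₁ (y + t) (y - t) + w₂ (y + t) (y - t)) y := fun t y =>
    (hasDerivAt_comp_of_partials dw₁ dw₂ cw₁.continuous cw₂.continuous (dplus' t y)
      (dminus' t y)).congr_deriv (by ring)
  have vtt : ∀ t y, HasDerivAt (fun s => w₁ (y + s) (y - s) - w₂ (y + s) (y - s))
      (w₁₁ (y + t) (y - t) + 2 * F (y + t) (y - t) + w₂₂ (y + t) (y - t)) t := fun t y =>
    ((hasDerivAt_comp_of_partials d₁₁ d₁₂ c₁₁.continuous cF.neg (dplus t y) (dminus t y)).sub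
      (hasDerivAt_comp_of_partials d₂₁ d₂₂ cF.neg c₂₂.continuous (dplus t y)
        (dminus t y))).congr_deriv (by ring)
  have vyy : ∀ t y, HasDerivAt (fun s => w₁ (s + t) (s - t) + w₂ (s + t) (s - t))
      (w₁₁ (y + t) (y - t) - 2 * F (y + t) (y - t) + w₂₂ (y + t) (y - t)) y := fun t y =>
    ((hasDerivAt_comp_of_partials d₁₁ d₁₂ c₁₁.continuous cF.neg (dplus' t y) (dminus' t y)).add
      (hasDerivAt_comp_of_partials d₂₁ d₂₂ cF.neg c₂₂.continuous (dplus' t y)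
        (dminus' t y))).congr_deriv (by ring)
  refine ⟨fun t y => w (y + t) (y - t), ?_, fun t y => ?_, fun y => ?_, fun y => ?_,
    fun t y h => hwS _ _ ?_⟩
  · exact hw2.comp ((contDiff_snd.add contDiff_fst).prodMk (contDiff_snd.sub contDiff_fst) :
      ContDiff ℝ 2 fun z : ℝ × ℝ => (z.2 + z.1, z.2 - z.1))
  · have e₁ : deriv (fun s => w (y + s) (y - s)) = _ := funext fun s => (vt s y).deriv
    have e₂ : deriv (fun s => w (s + t) (s - t)) = _ := funext fun s => (vy t s).deriv
    rw [e₁, e₂, (vtt t y).deriv, (vyy t y).deriv]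
    simp only [hF, q]
    ring_nf
  · simp only [add_zero, sub_zero, hw, f, triangleIntegral]
    simp
  · refine (vt 0 y).congr_deriv ?_
    simp [w₁, w₂]
    ring
  · rcases h with h | h
    · exact Or.inl (max_lt (by linarith [le_abs_self t]) (by linarith [neg_abs_le t]))
    · exact Or.inr (lt_min (by linarith [neg_abs_le t]) (by linarith [le_abs_self t]))

/-! ### The change of variables -/

theorem isLUB_degeneracy {θ : ℝ} (hθ : 2 ≤ θ) :
    IsLUB ((fun x : ℝ => x * |deriv (fun z : ℝ => z ^ θ) x| / x ^ θ) '' Ioc 0 1) θ := by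
  have h : (fun x : ℝ => x * |deriv (fun z : ℝ => z ^ θ) x| / x ^ θ) '' Ioc 0 1 = {θ} := by
    have h₁ : ∀ x ∈ Ioc (0 : ℝ) 1, x * |deriv (fun z : ℝ => z ^ θ) x| / x ^ θ = θ := by
      intro x hx
      have hp := Real.rpow_pos_of_pos hx.1 (θ - 1)
      rw [(Real.hasDerivAt_rpow_const (Or.inl hx.1.ne')).deriv, abs_of_pos (by positivity),
        show x ^ θ = x ^ (θ - 1) * x by rw [← Real.rpow_add_one hx.1.ne']; ring_nf]
      have := hx.1
      field_simp
    rw [image_congr h₁]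
    exact (nonempty_Ioc.2 one_pos).image_const θ
  rw [h]
  exact isLUB_singleton

theorem phi_eq {θ x : ℝ} (hx : 0 < x) : phi θ x =
    if θ = 2 then Real.log (1 / x) else 2 * (x ^ (1 - θ / 2) - 1) / (θ - 2) := by
  have h0 : (0 : ℝ) ∉ uIcc x 1 := fun h => by
    rw [mem_uIcc] at h
    rcases h with h | h <;> linarith [h.1, h.2]
  split_ifs with h
  · simp only [phi, h]
    norm_num
    simpa using integral_inv h0
  · have e : EqOn (fun s : ℝ => 1 / s ^ (θ / 2)) (fun s => s ^ (-(θ / 2))) (uIcc x 1) := by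
      intro s hs
      have hs0 : 0 < s := lt_of_lt_of_le (lt_min hx one_pos) hs.1
      simp [Real.rpow_neg hs0.le]
    rw [phi, intervalIntegral.integral_congr e, integral_rpow]
    · have h2 : θ - 2 ≠ 0 := sub_ne_zero.2 h
      have h3 : -(θ / 2) + 1 ≠ 0 := fun h' => h2 (by linarith)
      rw [Real.one_rpow, show -(θ / 2) + 1 = 1 - θ / 2 by ring] at *
      field_simp
      ring
    · exact Or.inr ⟨fun h' => h (by linarith), h0⟩

theorem hasDerivAt_phi {θ x : ℝ} (hx : 0 < x) : HasDerivAt (phi θ) (-(1 / x ^ (θ / 2))) x := by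
  have hc : ContinuousOn (fun s : ℝ => 1 / s ^ (θ / 2)) (Ioi 0) := fun s hs =>
    (continuousAt_const.div (Real.continuousAt_rpow_const s _ (Or.inl (ne_of_gt hs)))
      (Real.rpow_pos_of_pos hs _).ne').continuousWithinAt
  refine intervalIntegral.integral_hasDerivAt_left ?_
    (hc.stronglyMeasurableAtFilter isOpen_Ioi x hx) (hc.continuousAt (Ioi_mem_nhds hx))
  exact (hc.mono fun s hs => lt_of_lt_of_le (lt_min hx one_pos) hs.1).intervalIntegrable

theorem contDiffOn_rpow (r : ℝ) {n : ℕ∞ω} : ContDiffOn ℝ n (fun x : ℝ => x ^ r) (Ioi 0) :=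
  fun _ hx => (Real.contDiffAt_rpow_const_of_ne (ne_of_gt hx)).contDiffWithinAt

theorem contDiffOn_phi (θ : ℝ) : ContDiffOn ℝ ∞ (phi θ) (Ioi 0) := by
  by_cases h : θ = 2
  · refine ContDiffOn.congr (f := fun x => -Real.log x) ?_ fun x hx => by
      rw [phi_eq hx, if_pos h]; simp
    exact (Real.contDiffOn_log.mono fun x hx => ne_of_gt hx).neg
  · refine ContDiffOn.congr (f := fun x : ℝ => 2 * (x ^ (1 - θ / 2) - 1) / (θ - 2)) ?_ fun x hx => by
      rw [phi_eq hx, if_neg h]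
    exact (((contDiffOn_rpow _).sub contDiffOn_const).const_smul (2 : ℝ)).div_const _

theorem phi_one (θ : ℝ) : phi θ 1 = 0 := by simp [phi]

theorem strictAntiOn_phi (θ : ℝ) : StrictAntiOn (phi θ) (Ioi 0) := by
  refine strictAntiOn_of_deriv_neg (convex_Ioi 0) (contDiffOn_phi θ).continuousOn fun x hx => ?_
  rw [interior_Ioi] at hx
  rw [(hasDerivAt_phi hx).deriv]
  have := Real.rpow_pos_of_pos (show 0 < x from hx) (θ / 2)
  simp only [Left.neg_neg_iff]
  positivity

/-- The open set on which the formula for `ψ` makes sense. -/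
def psiDomain (θ : ℝ) : Set ℝ := {y | 0 < 2 + (θ - 2) * y}

theorem isOpen_psiDomain (θ : ℝ) : IsOpen (psiDomain θ) :=
  isOpen_lt continuous_const (by fun_prop)

theorem mem_psiDomain {θ y : ℝ} (hθ : 2 ≤ θ) (hy : 0 ≤ y) : y ∈ psiDomain θ := by
  have := mul_nonneg (sub_nonneg.2 hθ) hy
  simp only [psiDomain, mem_ofPred_eq]
  linarith

theorem psi_pos {θ y : ℝ} (hy : y ∈ psiDomain θ) : 0 < psi θ y := by
  unfold psi
  split_ifs
  · exact Real.exp_pos _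
  · exact Real.rpow_pos_of_pos (div_pos two_pos hy) _

theorem contDiffOn_psi (θ : ℝ) : ContDiffOn ℝ ∞ (psi θ) (psiDomain θ) := by
  by_cases h : θ = 2
  · refine ContDiffOn.congr (f := fun y => Real.exp (-y)) ?_ fun y _ => by rw [psi, if_pos h]
    exact (Real.contDiff_exp.comp contDiff_neg).contDiffOn
  · refine ContDiffOn.congr (f := fun y : ℝ => (2 / (2 + (θ - 2) * y)) ^ (2 / (θ - 2))) ?_
      fun y _ => by rw [psi, if_neg h]
    refine (contDiffOn_rpow _).comp (t := Ioi 0) ?_ fun y hy => mem_Ioi.2 (div_pos two_pos hy)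
    refine contDiffOn_const.div (contDiff_const.add (contDiff_const.mul contDiff_id)).contDiffOn
      fun y hy => ?_
    exact ne_of_gt (show 0 < 2 + (θ - 2) * y from hy)

theorem psi_phi {θ x : ℝ} (hx : 0 < x) : psi θ (phi θ x) = x := by
  rw [phi_eq hx, psi]
  split_ifs with h
  · simp [Real.exp_log hx]
  · have h2 : θ - 2 ≠ 0 := sub_ne_zero.2 h
    have hp := Real.rpow_pos_of_pos hx (1 - θ / 2)
    have e : 2 / (2 + (θ - 2) * (2 * (x ^ (1 - θ / 2) - 1) / (θ - 2))) = x ^ (-(1 - θ / 2)) := by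
      rw [Real.rpow_neg hx.le]
      generalize x ^ (1 - θ / 2) = p at *
      have e' : 2 + (θ - 2) * (2 * (p - 1) / (θ - 2)) = 2 * p := by field_simp; ring
      rw [e']
      field_simp
    rw [e, ← Real.rpow_mul hx.le]
    conv_rhs => rw [← Real.rpow_one x]
    congr 1
    field_simp
    ring

theorem phi_psi {θ y : ℝ} (hy : y ∈ psiDomain θ) : phi θ (psi θ y) = y := by
  rw [phi_eq (psi_pos hy), psi]
  split_ifs with h
  · simp
  · have h2 : θ - 2 ≠ 0 := sub_ne_zero.2 h
    have hy' : 0 < 2 + (θ - 2) * y := hy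
    have hp : 0 < 2 / (2 + (θ - 2) * y) := div_pos two_pos hy
    have e : 2 / (θ - 2) * (1 - θ / 2) = -1 := by field_simp; ring
    rw [← Real.rpow_mul hp.le, e, Real.rpow_neg_one]
    field_simp
    ring

theorem psi_zero {θ : ℝ} : psi θ 0 = 1 := by
  rw [← phi_one θ, psi_phi one_pos]

theorem mapsTo_phi (θ : ℝ) : MapsTo (phi θ) (Ioc 0 1) (Ici 0) := fun x hx => by
  rw [mem_Ici, ← phi_one θ]
  exact (strictAntiOn_phi θ).antitoneOn hx.1 (mem_Ioi.2 one_pos) hx.2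

theorem mapsTo_psi {θ : ℝ} (hθ : 2 ≤ θ) : MapsTo (psi θ) (Ici 0) (Ioc 0 1) := fun y hy => by
  have hd := mem_psiDomain hθ hy
  refine ⟨psi_pos hd, not_lt.1 fun h => ?_⟩
  have := strictAntiOn_phi θ (mem_Ioi.2 one_pos) (mem_Ioi.2 (psi_pos hd)) h
  rw [phi_one, phi_psi hd] at this
  exact (not_lt.2 hy) this

theorem invOn_psi_phi {θ : ℝ} (hθ : 2 ≤ θ) : InvOn (psi θ) (phi θ) (Ioc 0 1) (Ici 0) :=
  ⟨fun _ hx => psi_phi hx.1, fun _ hy => phi_psi (mem_psiDomain hθ hy)⟩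

theorem phi_pos {θ x : ℝ} (hx : x ∈ Ioo (0 : ℝ) 1) : 0 < phi θ x := by
  rw [← phi_one θ]
  exact strictAntiOn_phi θ hx.1 (mem_Ioi.2 one_pos) hx.2

theorem psi_mem_Ioo {θ y : ℝ} (hθ : 2 ≤ θ) (hy : 0 < y) : psi θ y ∈ Ioo (0 : ℝ) 1 := by
  have h := mapsTo_psi hθ (mem_Ici.2 hy.le)
  refine ⟨h.1, lt_of_le_of_ne h.2 fun h' => hy.ne' ?_⟩
  rw [← phi_psi (mem_psiDomain hθ hy.le), h', phi_one]

theorem lt_psi_iff {θ x y : ℝ} (hx : 0 < x) (hy : y ∈ psiDomain θ) : x < psi θ y ↔ y < phi θ x := by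
  conv_rhs => rw [← phi_psi hy]
  exact ((strictAntiOn_phi θ).lt_iff_gt (mem_Ioi.2 (psi_pos hy)) (mem_Ioi.2 hx)).symm

theorem potential_nonneg {θ : ℝ} (hθ : 2 ≤ θ) (y : ℝ) : 0 ≤ potential θ y := by
  have : 0 ≤ θ * (3 * θ - 4) / 4 := by nlinarith
  exact div_nonneg this (sq_nonneg _)

theorem potential_le {θ y : ℝ} (hθ : 2 ≤ θ) (hy : 0 ≤ y) :
    potential θ y ≤ θ * (3 * θ - 4) / 16 := by
  have h₁ : 0 ≤ θ * (3 * θ - 4) / 4 := by nlinarith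
  have h₂ := mul_nonneg (sub_nonneg.2 hθ) hy
  have h₃ : θ * (3 * θ - 4) / 16 = (θ * (3 * θ - 4) / 4) / 2 ^ 2 := by ring
  rw [potential, h₃]
  gcongr
  linarith

theorem exists_abs_potential_le {θ : ℝ} (hθ : 2 ≤ θ) :
    ∃ M : ℝ, ∀ y ∈ Ici (0 : ℝ), |potential θ y| ≤ M :=
  ⟨_, fun y hy => by
    rw [abs_of_nonneg (potential_nonneg hθ y)]
    exact potential_le hθ hy⟩

/-! ### Transformed initial data and their supports -/

theorem contDiffOn_transformData {θ : ℝ} {f : ℝ → ℝ} (hf : ContDiff ℝ ∞ f) :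
    ContDiffOn ℝ ∞ (transformData θ f) (psiDomain θ) :=
  ((contDiffOn_rpow _).comp (contDiffOn_psi θ) fun _ hy => psi_pos hy).mul
    (hf.comp_contDiffOn (contDiffOn_psi θ))

/-- A test function on `(0,b)` is supported in some `[c,d] ⊂ (0,b)`. -/
theorem IsTestFunction.exists_Icc {b : ℝ} {f : ℝ → ℝ} (hb : 0 < b)
    (hf : IsTestFunction (Ioo 0 b) f) :
    ∃ c d, 0 < c ∧ c ≤ d ∧ d < b ∧ ∀ x, x ∉ Icc c d → f x = 0 := by
  rcases (tsupport f).eq_empty_or_nonempty with h | h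
  · exact ⟨b / 2, b / 2, by linarith, le_rfl, by linarith, fun x _ =>
      image_eq_zero_of_notMem_tsupport (by simp [h])⟩
  · have hK : IsCompact (tsupport f) := hf.2.1
    refine ⟨sInf (tsupport f), sSup (tsupport f), (hf.2.2 (hK.sInf_mem h)).1,
      csInf_le_csSup h hK.bddBelow hK.bddAbove, (hf.2.2 (hK.sSup_mem h)).2, fun x hx => ?_⟩
    refine image_eq_zero_of_notMem_tsupport fun hx' => hx ?_
    exact ⟨csInf_le hK.bddBelow hx', le_csSup hK.bddAbove hx'⟩

theorem transformData_eq_zero {θ c d y : ℝ} {f : ℝ → ℝ} (hc : 0 < c) (hcd : c ≤ d)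
    (hf : ∀ x, x ∉ Icc c d → f x = 0) (hy : y ∈ psiDomain θ) (h : y ∉ Icc (phi θ d) (phi θ c)) :
    transformData θ f y = 0 := by
  rw [transformData, hf, mul_zero]
  refine fun hm => h ?_
  have ha := (strictAntiOn_phi θ).antitoneOn
  have hp := psi_pos hy
  rw [← phi_psi hy]
  exact ⟨ha hp (hc.trans_le hcd) hm.2, ha hc hp hm.1⟩

theorem transformData_isTestFunction {θ : ℝ} (hθ : 2 ≤ θ) {f : ℝ → ℝ}
    (hf : IsTestFunction (Ioo 0 1) f) : ContDiffOn ℝ ∞ (transformData θ f) (Ici 0) ∧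
      ∃ K : Set ℝ, IsCompact K ∧ K ⊆ Ioi 0 ∧
        ∀ y ∈ Ici (0 : ℝ), y ∉ K → transformData θ f y = 0 := by
  obtain ⟨c, d, hc, hcd, hd, h⟩ := hf.exists_Icc one_pos
  refine ⟨(contDiffOn_transformData hf.1).mono fun y hy => mem_psiDomain hθ hy,
    Icc (phi θ d) (phi θ c), isCompact_Icc, fun y hy => ?_, fun y hy hyK =>
      transformData_eq_zero hc hcd h (mem_psiDomain hθ hy) hyK⟩
  exact lt_of_lt_of_le (phi_pos ⟨hc.trans_le hcd, hd⟩) hy.1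

theorem isTestFunction_contDiffBump {b : ℝ} (hb : 0 < b) :
    ∃ f : ℝ → ℝ, IsTestFunction (Ioo 0 b) f ∧ f (b / 2) = 1 := by
  let φ : ContDiffBump (b / 2) := ⟨b / 8, b / 4, by linarith, by linarith⟩
  refine ⟨φ, ⟨φ.contDiff, φ.hasCompactSupport, ?_⟩, φ.one_of_mem_closedBall (by simp [φ]; linarith)⟩
  rw [φ.tsupport_eq, Real.closedBall_eq_Icc]
  intro x hx
  simp only [φ] at hx
  constructor <;> linarith [hx.1, hx.2]

/-! ### The Liouville transform -/

/-- The denominator of the potential becomes a power of `x`, which treats `θ = 2` and `θ > 2` at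
once. -/
theorem two_add_mul_phi {θ x : ℝ} (hx : 0 < x) :
    2 + (θ - 2) * phi θ x = 2 * x ^ (1 - θ / 2) := by
  rw [phi_eq hx]
  split_ifs with h
  · simp [h]
  · have h2 : θ - 2 ≠ 0 := sub_ne_zero.2 h
    generalize x ^ (1 - θ / 2) = p
    field_simp
    ring

theorem potential_phi {θ x : ℝ} (hx : 0 < x) :
    potential θ (phi θ x) = θ * (3 * θ - 4) / 16 * x ^ (θ - 2) := by
  have h : (x ^ (1 - θ / 2)) ^ 2 * x ^ (θ - 2) = 1 := by
    rw [← Real.rpow_natCast, ← Real.rpow_mul hx.le, ← Real.rpow_add hx]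
    push_cast
    ring_nf
    exact Real.rpow_zero x
  have hp : x ^ (1 - θ / 2) ≠ 0 := (Real.rpow_pos_of_pos hx _).ne'
  rw [potential, two_add_mul_phi hx, div_eq_iff (by positivity)]
  linear_combination (-(θ * (3 * θ - 4) / 4)) * h

/-- The factor `1 / z^θ` is kept in front so that multiplication by the coefficient `z^θ` leaves an
expression ready to be differentiated again. -/
theorem rpow_mul_hasDerivAt_liouville {θ z : ℝ} {g : ℝ → ℝ} (hz : 0 < z)
    (hg : DifferentiableAt ℝ g (phi θ z)) :
    HasDerivAt (fun z => 1 / z ^ (θ / 4) * g (phi θ z))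
      (1 / z ^ θ * (-(θ / 4) * z ^ (3 * θ / 4 - 1) * g (phi θ z)
        - z ^ (θ / 4) * deriv g (phi θ z))) z := by
  have h₁ : HasDerivAt (fun z : ℝ => z ^ (-(θ / 4))) _ z :=
    Real.hasDerivAt_rpow_const (Or.inl hz.ne')
  have h₂ := h₁.mul (hg.hasDerivAt.comp z (hasDerivAt_phi hz))
  have e₀ : ∀ᶠ z : ℝ in 𝓝 z, 1 / z ^ (θ / 4) * g (phi θ z) = z ^ (-(θ / 4)) * g (phi θ z) := by
    filter_upwards [Ioi_mem_nhds hz] with z hz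
    rw [Real.rpow_neg (le_of_lt hz), one_div]
  refine (h₂.congr_of_eventuallyEq e₀).congr_deriv ?_
  have e₁ : 1 / z ^ θ * z ^ (3 * θ / 4 - 1) = z ^ (-(θ / 4) - 1) := by
    rw [one_div, ← Real.rpow_neg hz.le, ← Real.rpow_add hz]
    ring_nf
  have e₂ : 1 / z ^ θ * z ^ (θ / 4) = z ^ (-(θ / 4)) * (1 / z ^ (θ / 2)) := by
    rw [one_div, one_div, ← Real.rpow_neg hz.le, ← Real.rpow_neg hz.le, ← Real.rpow_add hz,
      ← Real.rpow_add hz]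
    ring_nf
  simp only [Function.comp]
  linear_combination (θ / 4) * g (phi θ z) * e₁ + deriv g (phi θ z) * e₂

/-- The Liouville transform in the space variable. -/
theorem deriv_rpow_mul_deriv_liouville {θ x : ℝ} {f g : ℝ → ℝ} (hx : 0 < x)
    (hg : ContDiffAt ℝ 2 g (phi θ x))
    (hfg : ∀ᶠ z in 𝓝 x, f z = 1 / z ^ (θ / 4) * g (phi θ z)) :
    deriv (fun z => z ^ θ * deriv f z) x =
      1 / x ^ (θ / 4) * (deriv (deriv g) (phi θ x) - potential θ (phi θ x) * g (phi θ x)) := by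
  have hφ := (hasDerivAt_phi (θ := θ) hx)
  have hd : ∀ᶠ z in 𝓝 x, DifferentiableAt ℝ g (phi θ z) :=
    hφ.continuousAt.eventually ((hg.eventually (by simp)).mono fun y hy =>
      hy.differentiableAt (by norm_num))
  have e : (fun z => z ^ θ * deriv f z) =ᶠ[𝓝 x] fun z =>
      -(θ / 4) * z ^ (3 * θ / 4 - 1) * g (phi θ z) - z ^ (θ / 4) * deriv g (phi θ z) := by
    filter_upwards [hd, Ioi_mem_nhds hx, hfg.eventually_nhds] with z h₁ h₂ h₃
    have hz := Real.rpow_pos_of_pos (show 0 < z from h₂) θ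
    rw [((rpow_mul_hasDerivAt_liouville h₂ h₁).congr_of_eventuallyEq h₃).deriv]
    field_simp
  have hg₁ : HasDerivAt g _ (phi θ x) := (hg.differentiableAt (by norm_num)).hasDerivAt
  have hg₂ : HasDerivAt (deriv g) (deriv (deriv g) (phi θ x)) (phi θ x) :=
    (((hg.fderiv_right (m := 1) (by norm_num)).clm_apply contDiffAt_const).differentiableAt
      (by norm_num) : DifferentiableAt ℝ (fun y => fderiv ℝ g y 1) (phi θ x)).hasDerivAt
  have k₁ : HasDerivAt (fun z : ℝ => z ^ (3 * θ / 4 - 1)) _ x :=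
    Real.hasDerivAt_rpow_const (Or.inl hx.ne')
  have k₂ : HasDerivAt (fun z : ℝ => z ^ (θ / 4)) _ x :=
    Real.hasDerivAt_rpow_const (Or.inl hx.ne')
  have key := ((k₁.const_mul (-(θ / 4))).mul (hg₁.comp x hφ)).sub (k₂.mul (hg₂.comp x hφ))
  rw [e.deriv_eq]
  refine key.deriv.trans ?_
  rw [potential_phi hx]
  simp only [Function.comp]
  -- `e₁` makes the two terms in `g'` cancel, which is what the exponent `θ/4` is chosen for. `e₂`
  -- matches the coefficient of `g''`, and `e₃` turns the zeroth-order term `-(θ/4)(3θ/4 - 1)` into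
  -- the potential.
  have e₁ : x ^ (3 * θ / 4 - 1) * (1 / x ^ (θ / 2)) = x ^ (θ / 4 - 1) := by
    rw [one_div, ← Real.rpow_neg hx.le, ← Real.rpow_add hx]
    ring_nf
  have e₂ : x ^ (θ / 4) * (1 / x ^ (θ / 2)) = 1 / x ^ (θ / 4) := by
    rw [one_div, one_div, ← Real.rpow_neg hx.le, ← Real.rpow_neg hx.le, ← Real.rpow_add hx]
    ring_nf
  have e₃ : x ^ (3 * θ / 4 - 1 - 1) = 1 / x ^ (θ / 4) * x ^ (θ - 2) := by
    rw [one_div, ← Real.rpow_neg hx.le, ← Real.rpow_add hx]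
    ring_nf
  rw [e₃]
  linear_combination (θ / 4) * deriv g (phi θ x) * e₁ + deriv (deriv g) (phi θ x) * e₂

section Transform

variable {θ T : ℝ} {u v : ℝ → ℝ → ℝ}

theorem liouville_inverse (hθ : 2 ≤ θ)
    (h : ∀ t ∈ Icc 0 T, ∀ x ∈ Ioc (0 : ℝ) 1, u t x = 1 / x ^ (θ / 4) * v t (phi θ x)) :
    ∀ t ∈ Icc 0 T, ∀ y ∈ Ici (0 : ℝ), v t y = psi θ y ^ (θ / 4) * u t (psi θ y) := by
  intro t ht y hy
  have hp := mapsTo_psi hθ hy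
  have := Real.rpow_pos_of_pos hp.1 (θ / 4)
  rw [h t ht _ hp, phi_psi (mem_psiDomain hθ hy)]
  field_simp

theorem contDiffOn_liouville
    (h : ∀ t ∈ Icc 0 T, ∀ x ∈ Ioc (0 : ℝ) 1, u t x = 1 / x ^ (θ / 4) * v t (phi θ x))
    (hv : ContDiffOn ℝ 2 (fun z : ℝ × ℝ => v z.1 z.2) (Icc 0 T ×ˢ Ici 0)) :
    ContDiffOn ℝ 2 (fun z : ℝ × ℝ => u z.1 z.2) (Icc 0 T ×ˢ Ioc 0 1) := by
  refine ContDiffOn.congr (f := fun z : ℝ × ℝ => 1 / z.2 ^ (θ / 4) * v z.1 (phi θ z.2)) ?_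
    fun z hz => h z.1 hz.1 z.2 hz.2
  have hm : MapsTo (Prod.snd : ℝ × ℝ → ℝ) (Icc 0 T ×ˢ Ioc 0 1) (Ioi 0) := fun z hz => hz.2.1
  refine ContDiffOn.mul ?_ ?_
  · exact contDiffOn_const.div ((contDiffOn_rpow (θ / 4)).comp contDiffOn_snd hm)
      fun z hz => (Real.rpow_pos_of_pos hz.2.1 _).ne'
  · exact hv.comp (contDiffOn_fst.prodMk
      (((contDiffOn_phi θ).of_le ENat.LEInfty.out).comp contDiffOn_snd hm))
      fun z hz => ⟨hz.1, mapsTo_phi θ hz.2⟩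

theorem contDiffOn_liouville_inverse (hθ : 2 ≤ θ)
    (h : ∀ t ∈ Icc 0 T, ∀ x ∈ Ioc (0 : ℝ) 1, u t x = 1 / x ^ (θ / 4) * v t (phi θ x))
    (hu : ContDiffOn ℝ 2 (fun z : ℝ × ℝ => u z.1 z.2) (Icc 0 T ×ˢ Ioc 0 1)) :
    ContDiffOn ℝ 2 (fun z : ℝ × ℝ => v z.1 z.2) (Icc 0 T ×ˢ Ici 0) := by
  refine ContDiffOn.congr (f := fun z : ℝ × ℝ => psi θ z.2 ^ (θ / 4) * u z.1 (psi θ z.2)) ?_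
    fun z hz => liouville_inverse hθ h z.1 hz.1 z.2 hz.2
  have hψ : ContDiffOn ℝ 2 (fun z : ℝ × ℝ => psi θ z.2) (Icc 0 T ×ˢ Ici 0) :=
    ((contDiffOn_psi θ).of_le ENat.LEInfty.out).comp contDiffOn_snd
      fun z hz => mem_psiDomain hθ hz.2
  have hm : ∀ z ∈ (Icc 0 T ×ˢ Ici 0 : Set (ℝ × ℝ)), psi θ z.2 ∈ Ioc (0 : ℝ) 1 :=
    fun z hz => mapsTo_psi hθ hz.2
  exact ((contDiffOn_rpow (θ / 4)).comp hψ fun z hz => (hm z hz).1).mul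
    (hu.comp (contDiffOn_fst.prodMk hψ) fun z hz => ⟨hz.1, hm z hz⟩)

theorem liouville_pde
    (h : ∀ t ∈ Icc 0 T, ∀ x ∈ Ioc (0 : ℝ) 1, u t x = 1 / x ^ (θ / 4) * v t (phi θ x))
    (hv : ContDiffOn ℝ 2 (fun z : ℝ × ℝ => v z.1 z.2) (Icc 0 T ×ˢ Ici 0))
    {t x : ℝ} (ht : t ∈ Ioo 0 T) (hx : x ∈ Ioo (0 : ℝ) 1) :
    deriv (deriv fun s => u s x) t - deriv (fun z => z ^ θ * deriv (u t) z) x =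
      1 / x ^ (θ / 4) * (deriv (deriv fun s => v s (phi θ x)) t -
        deriv (deriv (v t)) (phi θ x) + potential θ (phi θ x) * v t (phi θ x)) := by
  have e₁ : (fun s => u s x) =ᶠ[𝓝 t] fun s => 1 / x ^ (θ / 4) * v s (phi θ x) := by
    filter_upwards [Ioo_mem_nhds ht.1 ht.2] with s hs
    exact h s (Ioo_subset_Icc_self hs) x (Ioo_subset_Ioc_self hx)
  have e₂ : deriv (deriv fun s => u s x) t =
      1 / x ^ (θ / 4) * deriv (deriv fun s => v s (phi θ x)) t := by
    rw [e₁.deriv.deriv_eq]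
    have : (deriv fun s => 1 / x ^ (θ / 4) * v s (phi θ x)) =
        fun s => 1 / x ^ (θ / 4) * deriv (fun s => v s (phi θ x)) s :=
      funext fun s => deriv_const_mul_field _
    rw [this, deriv_const_mul_field]
  have hv' : ContDiffAt ℝ 2 (fun z : ℝ × ℝ => v z.1 z.2) (t, phi θ x) :=
    hv.contDiffAt (prod_mem_nhds (Icc_mem_nhds ht.1 ht.2) (Ici_mem_nhds (phi_pos hx)))
  have hvt : ContDiffAt ℝ 2 (v t) (phi θ x) :=
    hv'.comp (phi θ x) (contDiffAt_const.prodMk contDiffAt_id)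
  rw [e₂, deriv_rpow_mul_deriv_liouville hx.1 hvt]
  · ring
  · filter_upwards [Ioo_mem_nhds hx.1 hx.2] with z hz
    exact h t (Ioo_subset_Icc_self ht) z (Ioo_subset_Ioc_self hz)

theorem transformData_phi {x : ℝ} (hx : 0 < x) (f : ℝ → ℝ) :
    transformData θ f (phi θ x) = x ^ (θ / 4) * f x := by
  rw [transformData, psi_phi hx]

/-- The factor `x^{-θ/4}` never vanishes on `(0,1]`, so it can be divided out of the equation, of
the Dirichlet condition and of the data. The Neumann condition is carried along separately: it lives
at `y = ∞`, where the half-line problem prescribes nothing. -/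
theorem liouville_iff (hθ : 2 ≤ θ) (hT : 0 < T) {u₀ u₁ : ℝ → ℝ}
    (h : ∀ t ∈ Icc 0 T, ∀ x ∈ Ioc (0 : ℝ) 1, u t x = 1 / x ^ (θ / 4) * v t (phi θ x)) :
    IsSolutionDW θ T u₀ u₁ u ↔
      IsSolutionW θ T (transformData θ u₀) (transformData θ u₁) v ∧
        ∀ t ∈ Ioo 0 T, Tendsto (fun x => x ^ θ * deriv (u t) x) (𝓝[>] 0) (𝓝 0) := by
  have hinv := liouville_inverse hθ h
  have h0 : (0 : ℝ) ∈ Icc 0 T := ⟨le_rfl, hT.le⟩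
  have hpos : ∀ {x : ℝ}, 0 < x → 0 < 1 / x ^ (θ / 4) := fun hx =>
    one_div_pos.2 (Real.rpow_pos_of_pos hx _)
  have hc : ∀ {x : ℝ}, 0 < x → 1 / x ^ (θ / 4) * x ^ (θ / 4) = 1 := fun hx =>
    one_div_mul_cancel (Real.rpow_pos_of_pos hx _).ne'
  have h1 : ∀ t ∈ Icc 0 T, u t 1 = v t 0 := fun t ht => by
    rw [h t ht 1 ⟨one_pos, le_rfl⟩, phi_one]; simp
  constructor
  · intro hu
    have hv := contDiffOn_liouville_inverse hθ h hu.contDiffOn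
    refine ⟨⟨hv, fun t ht y hy => ?_, fun t ht => ?_, fun y hy => ?_, fun y hy => ?_⟩, hu.neumann⟩
    · have hx := psi_mem_Ioo hθ hy
      have := liouville_pde h hv ht hx
      rw [hu.pde t ht _ hx, phi_psi (mem_psiDomain hθ (le_of_lt hy))] at this
      exact (mul_eq_zero.1 this.symm).resolve_left (hpos hx.1).ne'
    · rw [← h1 t (Ioo_subset_Icc_self ht), hu.dirichlet t ht]
    · rw [hinv 0 h0 y (Ioi_subset_Ici_self hy), hu.init _ (psi_mem_Ioo hθ hy), transformData]
    · refine ((hu.init_deriv _ (psi_mem_Ioo hθ hy)).const_mul (psi θ y ^ (θ / 4))).congr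
        (fun s hs => hinv s hs y (Ioi_subset_Ici_self hy)) (hinv 0 h0 y (Ioi_subset_Ici_self hy))
  · rintro ⟨hv, hn⟩
    refine ⟨contDiffOn_liouville h hv.contDiffOn, fun t ht x hx => ?_, fun t ht => ?_, hn,
      fun x hx => ?_, fun x hx => ?_⟩
    · rw [liouville_pde h hv.contDiffOn ht hx, hv.pde t ht _ (phi_pos hx), mul_zero]
    · rw [h1 t (Ioo_subset_Icc_self ht), hv.dirichlet t ht]
    · rw [h 0 h0 x (Ioo_subset_Ioc_self hx), hv.init _ (phi_pos hx), transformData_phi hx.1,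
        ← mul_assoc, hc hx.1, one_mul]
    · have := (hv.init_deriv (phi θ x) (phi_pos hx)).const_mul (1 / x ^ (θ / 4))
      rw [transformData_phi hx.1, ← mul_assoc, hc hx.1, one_mul] at this
      exact this.congr (fun s hs => h s hs x (Ioo_subset_Ioc_self hx))
        (h 0 h0 x (Ioo_subset_Ioc_self hx))

theorem hasDerivAt_psi_zero (θ : ℝ) (hθ : 2 ≤ θ) : HasDerivAt (psi θ) (-1) 0 := by
  have h0 := mem_psiDomain hθ le_rfl
  have hφ := hasDerivAt_phi (θ := θ) (x := psi θ 0) (by rw [psi_zero]; exact one_pos)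
  have := HasDerivAt.of_local_left_inverse (f := phi θ) (g := psi θ) (a := 0)
    ((contDiffOn_psi θ).continuousOn.continuousAt ((isOpen_psiDomain θ).mem_nhds h0)) hφ
    (by rw [psi_zero]; norm_num)
    (Filter.eventually_of_mem ((isOpen_psiDomain θ).mem_nhds h0) fun y hy => phi_psi hy)
  refine this.congr_deriv ?_
  rw [psi_zero]
  norm_num

/-- In the product rule the derivative of the weight is multiplied by the vanishing boundary value;
the weight equals `1` at the boundary, and `φ'(1) = ψ'(0) = -1` gives the sign. -/
theorem liouville_normal_derivative (hθ : 2 ≤ θ)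
    (h : ∀ t ∈ Icc 0 T, ∀ x ∈ Ioc (0 : ℝ) 1, u t x = 1 / x ^ (θ / 4) * v t (phi θ x))
    {t : ℝ} (ht : t ∈ Icc 0 T) (hu : u t 1 = 0) (d : ℝ) :
    HasDerivWithinAt (u t) d (Iic 1) 1 ↔ HasDerivWithinAt (v t) (-d) (Ici 0) 0 := by
  have hinv := liouville_inverse hθ h
  have hv : v t 0 = 0 := by rw [hinv t ht 0 (self_mem_Ici), psi_zero, hu, mul_zero]
  have hφ : HasDerivAt (phi θ) (-1) 1 := by simpa using hasDerivAt_phi (θ := θ) one_pos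
  have hψ := hasDerivAt_psi_zero θ hθ
  have r₁ : HasDerivAt (fun x : ℝ => 1 / x ^ (θ / 4)) (deriv (fun x : ℝ => 1 / x ^ (θ / 4)) 1) 1 := by
    refine DifferentiableAt.hasDerivAt ?_
    exact (differentiableAt_const _).div
      (Real.differentiableAt_rpow_const_of_ne _ one_ne_zero) (by simp)
  have r₂ : HasDerivAt (fun y : ℝ => psi θ y ^ (θ / 4)) (deriv (fun y => psi θ y ^ (θ / 4)) 0) 0 := by
    refine DifferentiableAt.hasDerivAt (hψ.differentiableAt.rpow_const (Or.inl ?_))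
    rw [psi_zero]
    exact one_ne_zero
  constructor
  · intro hd
    have hd' : HasDerivWithinAt (u t) d (Iic 1) (psi θ 0) := by rwa [psi_zero]
    have := r₂.hasDerivWithinAt.mul
      (hd'.comp (0 : ℝ) hψ.hasDerivWithinAt (s := Ici 0) fun y hy => (mapsTo_psi hθ hy).2)
    refine (this.congr (fun y hy => hinv t ht y hy) (hinv t ht 0 self_mem_Ici)).congr_deriv ?_
    simp [psi_zero, hu]
  · intro hd
    have hd' : HasDerivWithinAt (v t) (-d) (Ici 0) (phi θ 1) := by rwa [phi_one]
    have := r₁.hasDerivWithinAt.mul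
      (hd'.comp (1 : ℝ) hφ.hasDerivWithinAt (s := Ioc 0 1) fun y hy => mapsTo_phi θ hy)
    have h' : HasDerivWithinAt (u t) d (Ioc 0 1) 1 :=
      (this.congr (fun x hx => h t ht x hx) (h t ht 1 ⟨one_pos, le_rfl⟩)).congr_deriv
        (by simp [phi_one, hv])
    exact h'.mono_of_mem_nhdsWithin (Ioc_mem_nhdsLE one_pos)

end Transform

/-! ### Finite speed of propagation on the half-line -/

theorem uniqueDiffOn_strip {T : ℝ} (hT : 0 < T) : UniqueDiffOn ℝ (Icc 0 T ×ˢ Ici (0 : ℝ)) :=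
  (uniqueDiffOn_Icc hT).prod (uniqueDiffOn_Ici 0)

/-- The partial derivatives up to order two of a `C²` function on `[0,T] × [0,∞)`. -/
theorem exists_partials_strip {T : ℝ} (hT : 0 < T) {v : ℝ → ℝ → ℝ}
    (hv : ContDiffOn ℝ 2 (fun z : ℝ × ℝ => v z.1 z.2) (Icc 0 T ×ˢ Ici 0)) :
    ∃ vt vy vtt vty vyy : ℝ → ℝ → ℝ,
      (ContinuousOn (fun z : ℝ × ℝ => vt z.1 z.2) (Icc 0 T ×ˢ Ici 0) ∧
        ContinuousOn (fun z : ℝ × ℝ => vy z.1 z.2) (Icc 0 T ×ˢ Ici 0) ∧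
        ContinuousOn (fun z : ℝ × ℝ => vtt z.1 z.2) (Icc 0 T ×ˢ Ici 0) ∧
        ContinuousOn (fun z : ℝ × ℝ => vty z.1 z.2) (Icc 0 T ×ˢ Ici 0) ∧
        ContinuousOn (fun z : ℝ × ℝ => vyy z.1 z.2) (Icc 0 T ×ˢ Ici 0)) ∧
      (∀ t ∈ Icc 0 T, ∀ y ∈ Ici (0 : ℝ), HasDerivWithinAt (fun s => v s y) (vt t y) (Icc 0 T) t ∧
        HasDerivWithinAt (v t) (vy t y) (Ici 0) y) ∧
      ∀ t ∈ Ioo 0 T, ∀ y ∈ Ioi (0 : ℝ), HasDerivAt (fun s => vt s y) (vtt t y) t ∧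
        HasDerivAt (vt t) (vty t y) y ∧ HasDerivAt (fun s => vy s y) (vty t y) t ∧
        HasDerivAt (vy t) (vyy t y) y := by
  set D : Set (ℝ × ℝ) := Icc 0 T ×ˢ Ici 0 with hD
  have hu : UniqueDiffOn ℝ D := uniqueDiffOn_strip hT
  set f : ℝ × ℝ → ℝ := fun z => v z.1 z.2 with hf
  set f' := fderivWithin ℝ f D with hf'
  have h₁ : ContDiffOn ℝ 1 f' D := hv.fderivWithin hu (by norm_num)
  set f'' := fderivWithin ℝ f' D with hf''
  have h₂ : ContinuousOn f'' D := h₁.continuousOn_fderivWithin hu (by norm_num)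
  have c₁ : ∀ a : ℝ × ℝ, ContinuousOn (fun z => f' z a) D := fun a =>
    h₁.continuousOn.clm_apply continuousOn_const
  have c₂ : ∀ a b : ℝ × ℝ, ContinuousOn (fun z => f'' z a b) D := fun a b =>
    (h₂.clm_apply continuousOn_const).clm_apply continuousOn_const
  have d₁ : ∀ z ∈ D, HasFDerivWithinAt f (f' z) D z := fun z hz =>
    (hv.differentiableOn (by norm_num) z hz).hasFDerivWithinAt
  have hnhds : ∀ t ∈ Ioo 0 T, ∀ y ∈ Ioi (0 : ℝ), D ∈ 𝓝 (t, y) := fun t ht y hy =>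
    prod_mem_nhds (Icc_mem_nhds ht.1 ht.2) (Ici_mem_nhds hy)
  have d₂ : ∀ t ∈ Ioo 0 T, ∀ y ∈ Ioi (0 : ℝ), ∀ b : ℝ × ℝ,
      HasFDerivAt (fun z => f' z b) ((f'' (t, y)).flip b) (t, y) := fun t ht y hy b => by
    have hz : (t, y) ∈ D := mem_of_mem_nhds (hnhds t ht y hy)
    have := ((h₁.differentiableOn (by norm_num) _ hz).hasFDerivWithinAt.hasFDerivAt
      (hnhds t ht y hy)).clm_apply (hasFDerivAt_const b (t, y))
    simpa using! this
  -- Symmetry of the second derivative lets one function `vty` serve both as `∂_y v_t` and as `∂_t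
  -- v_y`.
  have hsymm : ∀ t ∈ Ioo 0 T, ∀ y ∈ Ioi (0 : ℝ), ∀ a b : ℝ × ℝ,
      f'' (t, y) a b = f'' (t, y) b a := fun t ht y hy a b => by
    have hn := hnhds t ht y hy
    have hi : (t, y) ∈ interior D := mem_interior_iff_mem_nhds.2 hn
    have := (hv.contDiffAt hn).isSymmSndFDerivAt (by simp)
    have e : f'' (t, y) = fderiv ℝ (fderiv ℝ f) (t, y) := by
      rw [hf'', fderivWithin_of_mem_nhds hn]
      refine Filter.EventuallyEq.fderiv_eq ?_
      filter_upwards [isOpen_interior.mem_nhds hi] with w hw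
      exact fderivWithin_of_mem_nhds (mem_interior_iff_mem_nhds.1 hw)
    rw [e]
    exact this a b
  have line₁ : ∀ t y : ℝ, HasDerivAt (fun s : ℝ => (s, y)) ((1, 0) : ℝ × ℝ) t := fun t y =>
    (hasDerivAt_id t).prodMk (hasDerivAt_const t y)
  have line₂ : ∀ t y : ℝ, HasDerivAt (fun s : ℝ => (t, s)) ((0, 1) : ℝ × ℝ) y := fun t y =>
    (hasDerivAt_const y t).prodMk (hasDerivAt_id y)
  refine ⟨fun t y => f' (t, y) (1, 0), fun t y => f' (t, y) (0, 1),
    fun t y => f'' (t, y) (1, 0) (1, 0), fun t y => f'' (t, y) (0, 1) (1, 0),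
    fun t y => f'' (t, y) (0, 1) (0, 1), ⟨c₁ _, c₁ _, c₂ _ _, c₂ _ _, c₂ _ _⟩,
    fun t ht y hy => ⟨?_, ?_⟩, fun t ht y hy => ⟨?_, ?_, ?_, ?_⟩⟩
  · exact (d₁ (t, y) ⟨ht, hy⟩).comp_hasDerivWithinAt t (line₁ t y).hasDerivWithinAt
      (show MapsTo (fun s : ℝ => (s, y)) (Icc 0 T) D from fun s hs => ⟨hs, hy⟩)
  · exact (d₁ (t, y) ⟨ht, hy⟩).comp_hasDerivWithinAt y (line₂ t y).hasDerivWithinAt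
      (show MapsTo (fun s : ℝ => (t, s)) (Ici 0) D from fun s hs => ⟨ht, hs⟩)
  · exact (d₂ t ht y hy (1, 0)).comp_hasDerivAt t (line₁ t y)
  · exact (d₂ t ht y hy (1, 0)).comp_hasDerivAt y (line₂ t y)
  · exact ((d₂ t ht y hy (0, 1)).comp_hasDerivAt t (line₁ t y)).congr_deriv
      (hsymm t ht y hy (1, 0) (0, 1))
  · exact (d₂ t ht y hy (0, 1)).comp_hasDerivAt y (line₂ t y)

/-- The square of the positive part is differentiable everywhere. It serves as a cutoff to the cone,
so that the energy can be integrated over a fixed interval. -/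
theorem hasDerivAt_max_sq (r : ℝ) :
    HasDerivAt (fun r : ℝ => max r 0 ^ 2) (2 * max r 0) r := by
  rcases lt_trichotomy r 0 with h | h | h
  · rw [max_eq_right h.le, mul_zero]
    refine (hasDerivAt_const r (0 : ℝ)).congr_of_eventuallyEq ?_
    filter_upwards [Iio_mem_nhds h] with s hs
    simp [max_eq_right (show s ≤ 0 from Iio_subset_Iic_self hs)]
  · subst h
    rw [max_self, mul_zero, hasDerivAt_iff_isLittleO]
    simp only [max_self, sub_zero, smul_zero]
    refine Asymptotics.IsBigO.trans_isLittleO (g := fun r : ℝ => r ^ 2) ?_ ?_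
    · refine Asymptotics.isBigO_of_le _ fun r => ?_
      simp only [ne_eq, OfNat.ofNat_ne_zero, not_false_eq_true, zero_pow, sub_zero, norm_pow,
        Real.norm_eq_abs, sq_abs, abs_of_nonneg (le_max_right r 0)]
      rcases max_cases r 0 with h | h <;> rw [h.1]
      rw [zero_pow two_ne_zero]
      exact sq_nonneg r
    · simpa using! Asymptotics.isLittleO_pow_id (𝕜 := ℝ) one_lt_two
  · rw [max_eq_left h.le]
    refine (((hasDerivAt_id r).pow 2).congr_deriv (by simp)).congr_of_eventuallyEq ?_
    filter_upwards [Ioi_mem_nhds h] with s hs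
    simp [max_eq_left (show 0 ≤ s from Ioi_subset_Ici_self hs)]

theorem IsSolutionW.dirichlet_Icc {θ T : ℝ} (hT : 0 < T) {v₀ v₁ : ℝ → ℝ} {v : ℝ → ℝ → ℝ}
    (hv : IsSolutionW θ T v₀ v₁ v) : ∀ t ∈ Icc 0 T, v t 0 = 0 := by
  have hc : ContinuousOn (fun t => v t 0) (Icc 0 T) :=
    hv.contDiffOn.continuousOn.comp (f := fun t : ℝ => (t, (0 : ℝ))) (by fun_prop)
      fun t ht => ⟨ht, self_mem_Ici⟩
  have : EqOn (fun t => v t 0) (fun _ => 0) (closure (Ioo 0 T)) :=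
    EqOn.of_subset_closure (s := Ioo 0 T) (fun t ht => hv.dirichlet t ht)
      (by rwa [closure_Ioo hT.ne]) continuousOn_const subset_closure le_rfl
  rwa [closure_Ioo hT.ne] at this

theorem IsSolutionW.vt_zero_eq_zero {θ T : ℝ} (hT : 0 < T) {v₀ v₁ : ℝ → ℝ} {v : ℝ → ℝ → ℝ}
    (hv : IsSolutionW θ T v₀ v₁ v) {t d : ℝ} (ht : t ∈ Icc 0 T)
    (hd : HasDerivWithinAt (fun s => v s 0) d (Icc 0 T) t) : d = 0 :=
  (uniqueDiffOn_Icc hT t ht).eq_deriv _ hd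
    ((hasDerivWithinAt_const t _ (0 : ℝ)).congr (fun s hs => hv.dirichlet_Icc hT s hs)
      (hv.dirichlet_Icc hT t ht))

/-- The pointwise inequality behind the energy estimate on a backward cone. -/
theorem cone_energy_ineq {m r s a b v q M : ℝ} (hm : 0 ≤ m) (hr : m = 0 ∨ |s| ≤ r)
    (hq : |q| ≤ M) :
    -4 * m * r * (a ^ 2 + b ^ 2 + v ^ 2) + 8 * m * s * (a * b) + 2 * m ^ 2 * (1 - q) * (v * a) ≤
      (1 + M) * (m ^ 2 * (a ^ 2 + b ^ 2 + v ^ 2)) := by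
  have hM : 0 ≤ M := (abs_nonneg q).trans hq
  -- The derivatives of the cutoff contribute a nonpositive term: the flux satisfies `2|ab| ≤ a² +
  -- b²`, and on the support of `m` the slope obeys `|s| ≤ r`. This is where unit speed enters.
  have h₁ : -4 * m * r * (a ^ 2 + b ^ 2 + v ^ 2) + 8 * m * s * (a * b) ≤ 0 := by
    rcases hr with rfl | hr
    · simp
    · have hr0 : 0 ≤ r := (abs_nonneg s).trans hr
      have e₁ : 2 * s * (a * b) ≤ r * (a ^ 2 + b ^ 2 + v ^ 2) := by
        calc 2 * s * (a * b) ≤ |2 * s * (a * b)| := le_abs_self _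
          _ = |s| * (2 * |a| * |b|) := by rw [abs_mul, abs_mul, abs_mul, abs_two]; ring
          _ ≤ r * (a ^ 2 + b ^ 2 + v ^ 2) := by
            refine mul_le_mul hr ?_ (by positivity) hr0
            have := two_mul_le_add_sq |a| |b|
            rw [sq_abs, sq_abs] at this
            nlinarith [sq_nonneg v]
      nlinarith
  have h₂ : 2 * ((1 - q) * (v * a)) ≤ (1 + M) * (a ^ 2 + b ^ 2 + v ^ 2) := by
    calc 2 * ((1 - q) * (v * a)) ≤ |2 * ((1 - q) * (v * a))| := le_abs_self _
      _ = |1 - q| * (2 * |v| * |a|) := by rw [abs_mul, abs_mul, abs_mul, abs_two]; ring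
      _ ≤ (1 + M) * (a ^ 2 + b ^ 2 + v ^ 2) := by
        refine mul_le_mul ?_ ?_ (by positivity) (by positivity)
        · exact (abs_sub _ _).trans (by rw [abs_one]; linarith)
        · have := two_mul_le_add_sq |v| |a|
          rw [sq_abs, sq_abs] at this
          nlinarith [sq_nonneg b]
  nlinarith [mul_le_mul_of_nonneg_left h₂ (sq_nonneg m)]

theorem continuousOn_integral_Icc {G : ℝ → ℝ → ℝ} {a b L : ℝ} (hL : 0 ≤ L)
    (hG : ContinuousOn (fun z : ℝ × ℝ => G z.1 z.2) (Icc a b ×ˢ Icc 0 L)) :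
    ContinuousOn (fun s => ∫ z in (0 : ℝ)..L, G s z) (Icc a b) := by
  obtain ⟨C, hC⟩ := (isCompact_Icc.prod isCompact_Icc).exists_bound_of_continuousOn hG
  intro s hs
  refine intervalIntegral.continuousWithinAt_of_dominated_interval (bound := fun _ => C) ?_ ?_
    intervalIntegrable_const ?_
  · filter_upwards [self_mem_nhdsWithin] with r hr
    rw [uIoc_of_le hL]
    have : ContinuousOn (G r) (Icc 0 L) := hG.comp (f := fun z : ℝ => (r, z)) (by fun_prop)
      fun z hz => ⟨hr, hz⟩
    exact (this.mono Ioc_subset_Icc_self).aestronglyMeasurable measurableSet_Ioc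
  · filter_upwards [self_mem_nhdsWithin] with r hr
    refine Eventually.of_forall fun z hz => hC (r, z) ⟨hr, ?_⟩
    rw [uIoc_of_le hL] at hz
    exact Ioc_subset_Icc_self hz
  · refine Eventually.of_forall fun z hz => ?_
    rw [uIoc_of_le hL] at hz
    exact (hG.comp (f := fun r : ℝ => (r, z)) (by fun_prop)
      (fun r hr => ⟨hr, Ioc_subset_Icc_self hz⟩ :
        MapsTo (fun r : ℝ => (r, z)) (Icc a b) (Icc a b ×ˢ Icc 0 L))) s hs

theorem hasDerivAt_integral_Icc {G G' : ℝ → ℝ → ℝ} {a b L : ℝ} (hL : 0 ≤ L)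
    (hG : ContinuousOn (fun z : ℝ × ℝ => G z.1 z.2) (Icc a b ×ˢ Icc 0 L))
    (hG' : ContinuousOn (fun z : ℝ × ℝ => G' z.1 z.2) (Icc a b ×ˢ Icc 0 L))
    (hd : ∀ s ∈ Ioo a b, ∀ z ∈ Ioc 0 L, HasDerivAt (fun s => G s z) (G' s z) s) {s : ℝ}
    (hs : s ∈ Ioo a b) :
    HasDerivAt (fun s => ∫ z in (0 : ℝ)..L, G s z) (∫ z in (0 : ℝ)..L, G' s z) s := by
  obtain ⟨C, hC⟩ := (isCompact_Icc.prod isCompact_Icc).exists_bound_of_continuousOn hG'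
  have hc : ∀ {F : ℝ → ℝ → ℝ}, ContinuousOn (fun z : ℝ × ℝ => F z.1 z.2) (Icc a b ×ˢ Icc 0 L) →
      ∀ r ∈ Ioo a b, ContinuousOn (F r) (Icc 0 L) := fun hF r hr =>
    hF.comp (f := fun z : ℝ => (r, z)) (by fun_prop) fun z hz => ⟨Ioo_subset_Icc_self hr, hz⟩
  have hm : ∀ {F : ℝ → ℝ → ℝ}, ContinuousOn (fun z : ℝ × ℝ => F z.1 z.2) (Icc a b ×ˢ Icc 0 L) →
      ∀ r ∈ Ioo a b, AEStronglyMeasurable (F r) (volume.restrict (uIoc 0 L)) := fun hF r hr => by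
    rw [uIoc_of_le hL]
    exact ((hc hF r hr).mono Ioc_subset_Icc_self).aestronglyMeasurable measurableSet_Ioc
  refine (intervalIntegral.hasDerivAt_integral_of_dominated_loc_of_deriv_le
    (F := G) (F' := G') (bound := fun _ => C) (Ioo_mem_nhds hs.1 hs.2) ?_ ?_ (hm hG' s hs) ?_
    intervalIntegrable_const ?_).2
  · filter_upwards [Ioo_mem_nhds hs.1 hs.2] with r hr using hm hG r hr
  · have := hc hG s hs
    rw [← uIcc_of_le hL] at this
    exact this.intervalIntegrable
  · refine Eventually.of_forall fun z hz r hr => hC (r, z) ⟨Ioo_subset_Icc_self hr, ?_⟩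
    rw [uIoc_of_le hL] at hz
    exact Ioc_subset_Icc_self hz
  · refine Eventually.of_forall fun z hz r hr => hd r hr z ?_
    rwa [uIoc_of_le hL] at hz

/-- A nonnegative function with `e(0) = 0` and `e' ≤ C e` vanishes. -/
theorem eq_zero_of_deriv_le_mul {e e' : ℝ → ℝ} {C b : ℝ} (hc : ContinuousOn e (Icc 0 b))
    (hd : ∀ s ∈ Ioo 0 b, HasDerivAt e (e' s) s) (hle : ∀ s ∈ Ioo 0 b, e' s ≤ C * e s)
    (h0 : e 0 = 0) (hpos : ∀ s ∈ Icc 0 b, 0 ≤ e s) : ∀ s ∈ Icc 0 b, e s = 0 := by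
  have hdm : ∀ s ∈ Ioo 0 b, HasDerivAt (fun s => Real.exp (-C * s) * e s)
      (Real.exp (-C * s) * (e' s - C * e s)) s := fun s hs =>
    ((((hasDerivAt_id s).const_mul (-C)).exp).mul (hd s hs)).congr_deriv (by simp; ring)
  have hanti : AntitoneOn (fun s => Real.exp (-C * s) * e s) (Icc 0 b) := by
    refine antitoneOn_of_deriv_nonpos (convex_Icc 0 b) (by fun_prop) ?_ ?_
    · rw [interior_Icc]
      exact fun s hs => (hdm s hs).differentiableAt.differentiableWithinAt
    · rw [interior_Icc]
      intro s hs
      rw [(hdm s hs).deriv]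
      exact mul_nonpos_of_nonneg_of_nonpos (Real.exp_pos _).le (sub_nonpos.2 (hle s hs))
  intro s hs
  have h := hanti (left_mem_Icc.2 (hs.1.trans hs.2)) hs hs.1
  simp only [h0, mul_zero] at h
  exact le_antisymm (nonpos_of_mul_nonpos_right h (Real.exp_pos _)) (hpos s hs)

/-- Gronwall for `e(s) = ∫ m² (v_t² + v_y² + v²) dz`, where `m = max((t₀-s)² - (z-y₀)², 0)` is
positive exactly inside the backward cone from `(t₀, y₀)` for `s < t₀`. The flux has no boundary
contribution, since `m = 0` at the far end and `v_t = 0` at `z = 0`. The term `v²` absorbs the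
potential, of which only boundedness is used, and lets `v = 0` be read off directly. -/
theorem IsSolutionW.eq_zero_of_mem_cone {θ T : ℝ} (hθ : 2 ≤ θ) (hT : 0 < T) {v₀ v₁ : ℝ → ℝ}
    {v : ℝ → ℝ → ℝ} (hv : IsSolutionW θ T v₀ v₁ v) {t₀ y₀ : ℝ} (ht₀ : t₀ ∈ Ioc 0 T) (hy₀ : 0 ≤ y₀)
    (hdata : ∀ z ∈ Ioi (0 : ℝ), |z - y₀| ≤ t₀ → v₀ z = 0 ∧ v₁ z = 0) :
    ∀ s ∈ Ioo 0 t₀, ∀ z ∈ Ioi (0 : ℝ), |z - y₀| < t₀ - s → v s z = 0 := by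
  obtain ⟨vt, vy, vtt, vty, vyy, ⟨ct, cy, ctt, cty, cyy⟩, hd₁, hd₂⟩ :=
    exists_partials_strip hT hv.contDiffOn
  obtain ⟨M, hM⟩ := exists_abs_potential_le hθ
  have cv := hv.contDiffOn.continuousOn
  set D : Set (ℝ × ℝ) := Icc 0 T ×ˢ Ici 0 with hD
  -- Beyond the base of the cone, so that the cutoff vanishes at `z = L`.
  set L := y₀ + t₀ + 1 with hL
  have hL0 : 0 < L := by linarith [ht₀.1]
  have hKD : Icc 0 t₀ ×ˢ Icc 0 L ⊆ D :=
    prod_mono (Icc_subset_Icc_right ht₀.2) Icc_subset_Ici_self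
  have hsT : ∀ s ∈ Ioo 0 t₀, s ∈ Ioo 0 T := fun s hs => ⟨hs.1, hs.2.trans_le ht₀.2⟩
  let m : ℝ → ℝ → ℝ := fun s z => max ((t₀ - s) ^ 2 - (z - y₀) ^ 2) 0
  have cm : ContinuousOn (fun z : ℝ × ℝ => m z.1 z.2) D :=
    (by fun_prop : Continuous fun z : ℝ × ℝ =>
      max ((t₀ - z.1) ^ 2 - (z.2 - y₀) ^ 2) 0).continuousOn
  have hm0 : ∀ s z, 0 ≤ m s z := fun s z => le_max_right _ _
  have hmt : ∀ s z, HasDerivAt (fun s => m s z ^ 2) (-4 * m s z * (t₀ - s)) s := fun s z =>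
    ((hasDerivAt_max_sq _).comp s
      ((((hasDerivAt_id s).const_sub t₀).pow 2).sub_const ((z - y₀) ^ 2))).congr_deriv
      (by simp only [m, id, Pi.pow_apply]; ring)
  have hmy : ∀ s z, HasDerivAt (fun z => m s z ^ 2) (-4 * m s z * (z - y₀)) z := fun s z =>
    ((hasDerivAt_max_sq _).comp z
      ((((hasDerivAt_id z).sub_const y₀).pow 2).const_sub ((t₀ - s) ^ 2))).congr_deriv
      (by simp only [m, id, Pi.pow_apply]; ring)
  let G : ℝ → ℝ → ℝ := fun s z => m s z ^ 2 * (vt s z ^ 2 + vy s z ^ 2 + v s z ^ 2)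
  let G' : ℝ → ℝ → ℝ := fun s z => -4 * m s z * (t₀ - s) * (vt s z ^ 2 + vy s z ^ 2 + v s z ^ 2) +
    m s z ^ 2 * (2 * vt s z * vtt s z + 2 * vy s z * vty s z + 2 * v s z * vt s z)
  let H : ℝ → ℝ → ℝ := fun s z => m s z ^ 2 * (2 * (vt s z * vy s z))
  let H' : ℝ → ℝ → ℝ := fun s z => -4 * m s z * (z - y₀) * (2 * (vt s z * vy s z)) +
    m s z ^ 2 * (2 * (vty s z * vy s z + vt s z * vyy s z))
  have cE : ContinuousOn (fun z : ℝ × ℝ => vt z.1 z.2 ^ 2 + vy z.1 z.2 ^ 2 + v z.1 z.2 ^ 2) D :=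
    ((ct.pow 2).add (cy.pow 2)).add (cv.pow 2)
  have cG : ContinuousOn (fun z : ℝ × ℝ => G z.1 z.2) D := (cm.pow 2).mul cE
  have cG' : ContinuousOn (fun z : ℝ × ℝ => G' z.1 z.2) D :=
    (((continuousOn_const.mul cm).mul (continuousOn_const.sub continuousOn_fst)).mul cE).add
      ((cm.pow 2).mul ((((continuousOn_const.mul ct).mul ctt).add
        ((continuousOn_const.mul cy).mul cty)).add ((continuousOn_const.mul cv).mul ct)))
  have cH : ContinuousOn (fun z : ℝ × ℝ => H z.1 z.2) D :=
    (cm.pow 2).mul (continuousOn_const.mul (ct.mul cy))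
  have cH' : ContinuousOn (fun z : ℝ × ℝ => H' z.1 z.2) D :=
    (((continuousOn_const.mul cm).mul (continuousOn_snd.sub continuousOn_const)).mul
      (continuousOn_const.mul (ct.mul cy))).add
      ((cm.pow 2).mul (continuousOn_const.mul ((cty.mul cy).add (ct.mul cyy))))
  have slice : ∀ {F : ℝ → ℝ → ℝ}, ContinuousOn (fun z : ℝ × ℝ => F z.1 z.2) D →
      ∀ s ∈ Icc 0 T, ContinuousOn (F s) (Icc 0 L) := fun hF s hs =>
    hF.comp (f := fun z : ℝ => (s, z)) (by fun_prop) fun z hz => ⟨hs, hz.1⟩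
  have hint : ∀ {F : ℝ → ℝ → ℝ}, ContinuousOn (fun z : ℝ × ℝ => F z.1 z.2) D →
      ∀ s ∈ Icc 0 T, IntervalIntegrable (F s) volume 0 L := fun hF s hs =>
    ContinuousOn.intervalIntegrable (by rw [uIcc_of_le hL0.le]; exact slice hF s hs)
  have hGd : ∀ s ∈ Ioo 0 t₀, ∀ z ∈ Ioc 0 L, HasDerivAt (fun s => G s z) (G' s z) s := by
    intro s hs z hz
    obtain ⟨k₁, -, k₃, -⟩ := hd₂ s (hsT s hs) z hz.1
    have k₀ := (hd₁ s (Ioo_subset_Icc_self (hsT s hs)) z hz.1.le).1.hasDerivAt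
      (Icc_mem_nhds (hsT s hs).1 (hsT s hs).2)
    exact ((hmt s z).mul (((k₁.pow 2).add (k₃.pow 2)).add (k₀.pow 2))).congr_deriv
      (by simp [G'])
  have hHd : ∀ s ∈ Ioo 0 t₀, ∀ z ∈ Ioo 0 L, HasDerivAt (H s) (H' s z) z := by
    intro s hs z hz
    obtain ⟨-, k₂, -, k₄⟩ := hd₂ s (hsT s hs) z hz.1
    exact (hmy s z).mul ((k₂.mul k₄).const_mul 2)
  have hflux : ∀ s ∈ Ioo 0 t₀, ∫ z in (0 : ℝ)..L, H' s z = 0 := by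
    intro s hs
    have hs' := Ioo_subset_Icc_self (hsT s hs)
    rw [intervalIntegral.integral_eq_sub_of_hasDerivAt_of_le hL0.le (slice cH s hs')
      (hHd s hs) (hint cH' s hs')]
    have e₁ : m s L = 0 := max_eq_right (by nlinarith [hs.1, hs.2])
    have e₂ : vt s 0 = 0 := hv.vt_zero_eq_zero hT hs' (hd₁ s hs' 0 self_mem_Ici).1
    simp [H, e₁, e₂]
  -- Once `v_tt` is replaced using the equation, the terms `v_y v_ty` and `v_t v_yy` in `G'` are
  -- those of the flux derivative `H'`; what remains is the left side of `cone_energy_ineq`.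
  have hineq : ∀ s ∈ Ioo 0 t₀, ∀ z ∈ Ioo 0 L, G' s z ≤ H' s z + (1 + M) * G s z := by
    intro s hs z hz
    obtain ⟨k₁, -, -, k₄⟩ := hd₂ s (hsT s hs) z hz.1
    have hpde := hv.pde s (hsT s hs) z hz.1
    have e₁ : deriv (deriv fun s => v s z) s = vtt s z := by
      have : (deriv fun s => v s z) =ᶠ[𝓝 s] fun s => vt s z := by
        filter_upwards [Ioo_mem_nhds (hsT s hs).1 (hsT s hs).2] with r hr
        exact ((hd₁ r (Ioo_subset_Icc_self hr) z hz.1.le).1.hasDerivAt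
          (Icc_mem_nhds hr.1 hr.2)).deriv
      rw [this.deriv_eq, k₁.deriv]
    have e₂ : deriv (deriv (v s)) z = vyy s z := by
      have : deriv (v s) =ᶠ[𝓝 z] vy s := by
        filter_upwards [Ioi_mem_nhds hz.1] with r hr
        exact ((hd₁ s (Ioo_subset_Icc_self (hsT s hs)) r (Ioi_subset_Ici_self hr)).2.hasDerivAt
          (Ici_mem_nhds hr)).deriv
      rw [this.deriv_eq, k₄.deriv]
    rw [e₁, e₂] at hpde
    have hvtt : vtt s z = vyy s z - potential θ z * v s z := by linarith
    have hcone : m s z = 0 ∨ |z - y₀| ≤ t₀ - s := by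
      by_contra! h
      refine h.1 (max_eq_right ?_)
      have := mul_self_le_mul_self (sub_nonneg.2 hs.2.le) h.2.le
      rw [abs_mul_abs_self] at this
      nlinarith
    have := cone_energy_ineq (a := vt s z) (b := vy s z) (v := v s z) (hm0 s z) hcone
      (hM z hz.1.le)
    simp only [G, G', H', hvtt]
    linarith
  let e : ℝ → ℝ := fun s => ∫ z in (0 : ℝ)..L, G s z
  have hG0 : ∀ s z, 0 ≤ G s z := fun s z => by
    have := hm0 s z
    positivity
  have he0 : e 0 = 0 := by
    have hz : ∀ z ∈ Ioc 0 L, G 0 z = 0 := by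
      intro z hz
      -- Strictly inside the base, `v(0,·)` vanishes on a neighbourhood, so `v_y(0,z) = 0` as well;
      -- elsewhere the cutoff is zero.
      by_cases hc : |z - y₀| < t₀
      · have hnear : ∀ᶠ r in 𝓝 z, v 0 r = 0 := by
          have : Continuous fun r : ℝ => |r - y₀| := by fun_prop
          filter_upwards [Ioi_mem_nhds hz.1, this.continuousAt.eventually_lt_const hc] with r h₁ h₂
          rw [hv.init r h₁, (hdata r h₁ h₂.le).1]
        have h0T : (0 : ℝ) ∈ Icc 0 T := left_mem_Icc.2 hT.le
        have a₁ : vy 0 z = 0 :=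
          ((hd₁ 0 h0T z hz.1.le).2.hasDerivAt (Ici_mem_nhds hz.1)).unique
            ((hasDerivAt_const z (0 : ℝ)).congr_of_eventuallyEq hnear)
        have a₂ : vt 0 z = 0 := by
          have := (uniqueDiffOn_Icc hT 0 h0T).eq_deriv _ (hd₁ 0 h0T z hz.1.le).1
            (hv.init_deriv z hz.1)
          rw [this, (hdata z hz.1 hc.le).2]
        simp [G, a₁, a₂, hnear.self_of_nhds]
      · have : m 0 z = 0 := by
          refine max_eq_right ?_
          have := mul_self_le_mul_self ht₀.1.le (not_lt.1 hc)
          rw [abs_mul_abs_self] at this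
          nlinarith
        simp [G, this]
    refine intervalIntegral.integral_zero_ae (Eventually.of_forall fun z h => hz z ?_)
    rwa [uIoc_of_le hL0.le] at h
  have hzero := eq_zero_of_deriv_le_mul (e := e) (C := 1 + M)
    (continuousOn_integral_Icc hL0.le (cG.mono hKD))
    (fun s hs => hasDerivAt_integral_Icc hL0.le (cG.mono hKD) (cG'.mono hKD) hGd hs)
    (fun s hs => by
      have hs' := Ioo_subset_Icc_self (hsT s hs)
      calc ∫ z in (0 : ℝ)..L, G' s z ≤ ∫ z in (0 : ℝ)..L, (H' s z + (1 + M) * G s z) :=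
            intervalIntegral.integral_mono_on_of_le_Ioo hL0.le (hint cG' s hs')
              ((hint cH' s hs').add ((hint cG s hs').const_mul _)) (hineq s hs)
        _ = (1 + M) * e s := by
            rw [intervalIntegral.integral_add (hint cH' s hs') ((hint cG s hs').const_mul _),
              hflux s hs, zero_add, intervalIntegral.integral_const_mul])
    he0 (fun s _ => intervalIntegral.integral_nonneg hL0.le fun z _ => hG0 s z)
  intro s hs z hz hsz
  by_contra hne
  have hs' := Ioo_subset_Icc_self (hsT s hs)
  refine (intervalIntegral.integral_pos hL0 (slice cG s hs') (fun z _ => hG0 s z)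
    ⟨z, ⟨le_of_lt hz, ?_⟩, ?_⟩).ne' (hzero s (Ioo_subset_Icc_self hs))
  · have := (le_abs_self (z - y₀)).trans hsz.le
    linarith [hs.1]
  · have : 0 < m s z := by
      refine lt_max_of_lt_left (sub_pos.2 ?_)
      rw [← sq_abs (z - y₀)]
      exact pow_lt_pow_left₀ hsz (abs_nonneg _) two_ne_zero
    have := pow_pos this 2
    have : 0 < v s z ^ 2 := by positivity
    simp only [G]
    positivity

/-- The cone estimate gives `v(s,y) = 0` for `0 < s < t`; the apex is reached by continuity along
the axis of the cone. -/
theorem IsSolutionW.eq_zero_of_data {θ T : ℝ} (hθ : 2 ≤ θ) (hT : 0 < T) {v₀ v₁ : ℝ → ℝ}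
    {v : ℝ → ℝ → ℝ} (hv : IsSolutionW θ T v₀ v₁ v) {t y : ℝ} (ht : t ∈ Icc 0 T)
    (hy : y ∈ Ici (0 : ℝ))
    (hdata : ∀ z ∈ Ioi (0 : ℝ), |z - y| ≤ t → v₀ z = 0 ∧ v₁ z = 0) : v t y = 0 := by
  rcases eq_or_lt_of_le (show 0 ≤ y from hy) with rfl | hy0
  · exact hv.dirichlet_Icc hT t ht
  rcases eq_or_lt_of_le ht.1 with rfl | ht0
  · rw [hv.init y hy0, (hdata y hy0 (by simp)).1]
  have h := hv.eq_zero_of_mem_cone hθ hT ⟨ht0, ht.2⟩ hy hdata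
  have hc : ContinuousOn (fun s => v s y) (Icc 0 t) :=
    hv.contDiffOn.continuousOn.comp (f := fun s : ℝ => (s, y)) (by fun_prop)
      fun s hs => ⟨⟨hs.1, hs.2.trans ht.2⟩, hy⟩
  have : EqOn (fun s => v s y) (fun _ => 0) (Icc 0 t) :=
    EqOn.of_subset_closure (s := Ioo 0 t)
      (fun s hs => h s hs y hy0 (by simpa using hs.2)) hc continuousOn_const Ioo_subset_Icc_self
      (by rw [closure_Ioo ht0.ne])
  exact this (right_mem_Icc.2 ht.1)

/-- For `0 < t < T` the backward cones from `[0, T-t]` have bases that meet `y > 0` inside `(0,T]`,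
so `v(t,·)` vanishes on a whole interval at the boundary. The times `0` and `T` follow by continuity
of `v_y`. -/
theorem IsSolutionW.hasDerivWithinAt_zero {θ T : ℝ} (hθ : 2 ≤ θ) (hT : 0 < T) {v₀ v₁ : ℝ → ℝ}
    {v : ℝ → ℝ → ℝ} (hv : IsSolutionW θ T v₀ v₁ v)
    (hdata : ∀ z ∈ Ioc 0 T, v₀ z = 0 ∧ v₁ z = 0) :
    ∀ t ∈ Icc 0 T, HasDerivWithinAt (v t) 0 (Ici 0) 0 := by
  obtain ⟨vt, vy, vtt, vty, vyy, ⟨ct, cy, ctt, cty, cyy⟩, hd₁, hd₂⟩ :=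
    exists_partials_strip hT hv.contDiffOn
  have hc : ContinuousOn (fun t => vy t 0) (Icc 0 T) :=
    cy.comp (f := fun t : ℝ => (t, (0 : ℝ))) (by fun_prop) fun t ht => ⟨ht, self_mem_Ici⟩
  have h : ∀ t ∈ Ioo 0 T, vy t 0 = 0 := by
    intro t ht
    have hz : ∀ y ∈ Icc 0 (T - t), v t y = 0 := fun y hy =>
      hv.eq_zero_of_data hθ hT (Ioo_subset_Icc_self ht) hy.1 fun z hz hzy =>
        hdata z ⟨hz, by linarith [(le_abs_self (z - y)).trans hzy, hy.2]⟩
    have hpos : 0 < T - t := sub_pos.2 ht.2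
    have e : HasDerivWithinAt (v t) 0 (Icc 0 (T - t)) 0 :=
      (hasDerivWithinAt_const 0 _ (0 : ℝ)).congr hz (hz 0 (left_mem_Icc.2 hpos.le))
    exact (uniqueDiffOn_Icc hpos 0 (left_mem_Icc.2 hpos.le)).eq_deriv _
      ((hd₁ t (Ioo_subset_Icc_self ht) 0 self_mem_Ici).2.mono Icc_subset_Ici_self) e
  have h' : EqOn (fun t => vy t 0) (fun _ => 0) (Icc 0 T) :=
    EqOn.of_subset_closure (s := Ioo 0 T) h hc continuousOn_const Ioo_subset_Icc_self
      (by rw [closure_Ioo hT.ne])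
  intro t ht
  have := (hd₁ t ht 0 self_mem_Ici).2
  rwa [show vy t 0 = 0 from h' ht] at this

/-! ### Green's formula and uniqueness of mild solutions -/

theorem integral_mu01 (k : ℝ → ℝ) : ∫ x, k x ∂mu01 = ∫ x in (0 : ℝ)..1, k x := by
  rw [intervalIntegral.integral_of_le zero_le_one, integral_Ioc_eq_integral_Ioo]

theorem integrable_mu01_iff {k : ℝ → ℝ} :
    Integrable k mu01 ↔ IntervalIntegrable k volume 0 1 := by
  rw [intervalIntegrable_iff_integrableOn_Ioo_of_le zero_le_one]
  rfl

/-- A function that vanishes at `0` and has a square integrable derivative is `O(√x)` at `0`. -/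
theorem exists_abs_le_sqrt {w : ℝ → ℝ} (hw : AbsolutelyContinuousOnInterval w 0 1)
    (hw0 : w 0 = 0) (hw' : MemLp (deriv w) 2 mu01) :
    ∃ N, ∀ c ∈ Ioo (0 : ℝ) 1, |w c| ≤ N * √c := by
  have hsq : IntervalIntegrable (fun x => deriv w x ^ 2) volume 0 1 :=
    integrable_mu01_iff.1 hw'.integrable_sq
  set A := ∫ x in (0 : ℝ)..1, deriv w x ^ 2
  have hA : 0 ≤ A := intervalIntegral.integral_nonneg zero_le_one fun x _ => sq_nonneg _
  refine ⟨(A + 1) / 2, fun c hc => ?_⟩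
  have hsub : uIcc 0 c ⊆ uIcc (0 : ℝ) 1 := by
    rw [uIcc_of_le hc.1.le, uIcc_of_le zero_le_one]
    exact Icc_subset_Icc_right hc.2.le
  have hr : 0 < √c := Real.sqrt_pos.2 hc.1
  have hcc : √c * √c = c := Real.mul_self_sqrt hc.1.le
  have hic : IntervalIntegrable (fun x => deriv w x ^ 2) volume 0 c := hsq.mono_set hsub
  have h₁ : w c = ∫ x in (0 : ℝ)..c, deriv w x := by
    rw [(hw.mono hsub).integral_deriv_eq_sub, hw0, sub_zero]
  have h₂ : |w c| ≤ ∫ x in (0 : ℝ)..c, |deriv w x| := by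
    rw [h₁]
    exact intervalIntegral.abs_integral_le_integral_abs hc.1.le
  -- Young's inequality with parameter `√c`, chosen so that both terms integrate over `(0,c)` to
  -- `O(√c)`.
  have h₃ : ∫ x in (0 : ℝ)..c, |deriv w x| ≤
      ∫ x in (0 : ℝ)..c, (√c / 2 * deriv w x ^ 2 + 1 / (2 * √c)) := by
    refine intervalIntegral.integral_mono_on hc.1.le
      (hw.intervalIntegrable_deriv.mono_set hsub).abs
      ((hic.const_mul _).add intervalIntegrable_const) fun x _ => ?_
    have : 0 ≤ (√c * |deriv w x| - 1) ^ 2 / (2 * √c) := by positivity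
    have e : (√c * |deriv w x| - 1) ^ 2 / (2 * √c) =
        √c / 2 * deriv w x ^ 2 + 1 / (2 * √c) - |deriv w x| := by
      rw [← sq_abs (deriv w x)]
      field_simp
      ring
    linarith
  have h₄ : ∫ x in (0 : ℝ)..c, deriv w x ^ 2 ≤ A :=
    intervalIntegral.integral_mono_interval le_rfl hc.1.le hc.2.le
      (Eventually.of_forall fun x => sq_nonneg _) hsq
  rw [intervalIntegral.integral_add (hic.const_mul _) intervalIntegrable_const,
    intervalIntegral.integral_const_mul, intervalIntegral.integral_const, sub_zero,
    smul_eq_mul] at h₃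
  have e : c * (1 / (2 * √c)) = √c / 2 := by
    rw [mul_one_div, div_eq_div_iff (by positivity) (by norm_num)]
    linear_combination (-2) * hcc
  rw [e] at h₃
  nlinarith [mul_le_mul_of_nonneg_left h₄ (by positivity : 0 ≤ √c / 2)]

/-- A locally absolutely continuous function in `L²` does not see boundary terms of size `√x`. -/
theorem boundary_term_eq_zero {F w : ℝ → ℝ} {J N : ℝ} (hF : MemLp F 2 mu01)
    (hw : ∀ c ∈ Ioo (0 : ℝ) 1, |w c| ≤ N * √c)
    (hlim : Tendsto (fun c => F c * w c) (𝓝[>] 0) (𝓝 J)) : J = 0 := by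
  by_contra hJ
  have hJ0 : 0 < |J| := abs_pos.2 hJ
  have h₁ : ∀ᶠ c in 𝓝[>] (0 : ℝ), |J| / 2 < |F c * w c| :=
    hlim.abs.eventually_const_lt (by linarith)
  have h₂ := h₁.and (Ioo_mem_nhdsGT (zero_lt_one' ℝ))
  obtain ⟨δ, hδ, hsub⟩ := mem_nhdsGT_iff_exists_Ioo_subset.1 h₂
  have hδ0 : (0 : ℝ) < δ := hδ
  have hsub1 : Ioo 0 δ ⊆ Ioo 0 1 := fun c hc => (hsub hc).2
  have hint : IntegrableOn (fun c => (2 * N / |J|) ^ 2 * F c ^ 2) (Ioo 0 δ) :=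
    (IntegrableOn.mono_set (show IntegrableOn (fun c => F c ^ 2) (Ioo 0 1) volume from hF.integrable_sq)
      hsub1).const_mul _
  -- If `J ≠ 0`, then `|J|/2 ≤ |F(c)| N √c` near `0` gives `1/c ≤ (2N/|J|)² F(c)²`, and `1/c` would
  -- be integrable at `0`.
  have hinv : IntegrableOn (fun c : ℝ => c⁻¹) (Ioo 0 δ) := by
    refine Integrable.mono' hint measurable_inv.aestronglyMeasurable ?_
    filter_upwards [ae_restrict_mem measurableSet_Ioo] with c hc
    have hc0 : 0 < c := hc.1
    obtain ⟨k₁, k₂⟩ := hsub hc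
    have k₃ : |J| / 2 ≤ |F c| * (N * √c) := by
      refine (le_of_lt k₁).trans ?_
      rw [abs_mul]
      exact mul_le_mul_of_nonneg_left (hw c k₂) (abs_nonneg _)
    have k₄ : (|J| / 2) ^ 2 ≤ F c ^ 2 * (N ^ 2 * c) := by
      have := pow_le_pow_left₀ (by positivity) k₃ 2
      rwa [mul_pow, mul_pow, Real.sq_sqrt hc0.le, sq_abs (F c)] at this
    rw [Real.norm_eq_abs, abs_of_pos (inv_pos.2 hc0), div_pow, inv_le_iff_one_le_mul₀ hc0,
      div_mul_eq_mul_div, div_mul_eq_mul_div, le_div_iff₀ (by positivity)]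
    nlinarith
  have := (intervalIntegrable_iff_integrableOn_Ioo_of_le hδ0.le).2 hinv
  rw [intervalIntegrable_inv_iff] at this
  rcases this with h | h
  · exact hδ0.ne h
  · exact h left_mem_uIcc

/-- Integration by parts on `[c,1]`, then `c → 0`. At `1` the Dirichlet condition applies. At `0`
the function `F` may be unbounded, but `F(c) w(c)` converges because both integrands are integrable,
and `boundary_term_eq_zero` forces the limit to be zero. -/
theorem integral_mul_deriv_of_isH1 {a F G w : ℝ → ℝ} (ha : ∀ x ∈ Ioo (0 : ℝ) 1, 0 ≤ a x)
    (hF : IsH1 a F) (hG : IsH1 a G) (hw : AbsolutelyContinuousOnInterval w 0 1)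
    (hwG : w =ᵐ[mu01] fun x => a x * deriv G x) (hw0 : w 0 = 0) (hw' : MemLp (deriv w) 2 mu01) :
    ∫ x, F x * deriv w x ∂mu01 =
      -∫ x, (√(a x) * deriv F x) * (√(a x) * deriv G x) ∂mu01 := by
  have e : (fun x => (√(a x) * deriv F x) * (√(a x) * deriv G x)) =ᵐ[mu01]
      fun x => deriv F x * w x := by
    filter_upwards [hwG, ae_restrict_mem measurableSet_Ioo] with x hx hx01
    rw [hx, mul_mul_mul_comm, Real.mul_self_sqrt (ha x hx01)]
    ring
  have i₁ : Integrable (fun x => deriv F x * w x) mu01 :=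
    (hF.memLp_deriv.integrable_mul hG.memLp_deriv).congr e
  have i₂ : Integrable (fun x => F x * deriv w x) mu01 := hF.memLp.integrable_mul hw'
  have i₃ := integrable_mu01_iff.1 (i₁.add i₂)
  obtain ⟨N, hNw⟩ := exists_abs_le_sqrt hw hw0 hw'
  have hparts : ∀ c ∈ Ioo (0 : ℝ) 1,
      ∫ x in c..1, (deriv F x * w x + F x * deriv w x) = -(F c * w c) := by
    intro c hc
    have hsub : uIcc c 1 ⊆ uIcc (0 : ℝ) 1 := by
      rw [uIcc_of_le hc.2.le, uIcc_of_le zero_le_one]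
      exact Icc_subset_Icc_left hc.1.le
    rw [(hF.locAC c hc).integral_deriv_mul_eq_sub (hw.mono hsub), hF.dirichlet, zero_mul, zero_sub]
  have hcont : ContinuousWithinAt
      (fun c => ∫ x in c..1, (deriv F x * w x + F x * deriv w x)) (uIcc 0 1) 0 :=
    intervalIntegral.continuousOn_primitive_interval_left
      (by rw [uIcc_of_le zero_le_one, integrableOn_Icc_iff_integrableOn_Ioo]; exact i₁.add i₂)
      0 left_mem_uIcc
  have hlim : Tendsto (fun c => F c * w c) (𝓝[>] 0)
      (𝓝 (-∫ x in (0 : ℝ)..1, (deriv F x * w x + F x * deriv w x))) := by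
    have h₁ : Tendsto (fun c => ∫ x in c..1, (deriv F x * w x + F x * deriv w x)) (𝓝[>] 0)
        (𝓝 (∫ x in (0 : ℝ)..1, (deriv F x * w x + F x * deriv w x))) := by
      rw [uIcc_of_le zero_le_one] at hcont
      rw [← nhdsWithin_Ioo_eq_nhdsGT (zero_lt_one' ℝ)]
      exact hcont.mono_left (nhdsWithin_mono _ Ioo_subset_Icc_self)
    refine h₁.neg.congr' ?_
    filter_upwards [Ioo_mem_nhdsGT (zero_lt_one' ℝ)] with c hc
    rw [hparts c hc, neg_neg]
  have hJ := boundary_term_eq_zero hF.memLp hNw hlim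
  have hsum : ∫ x, deriv F x * w x ∂mu01 + ∫ x, F x * deriv w x ∂mu01 = 0 := by
    rw [← integral_add i₁ i₂, integral_mu01]
    linarith
  rw [integral_congr_ae e]
  linarith

theorem inner_eq_integral {f g : L2} {F G : ℝ → ℝ} (hf : f =ᵐ[mu01] F) (hg : g =ᵐ[mu01] G) :
    inner ℝ f g = ∫ x, F x * G x ∂mu01 := by
  rw [L2.inner_def]
  refine integral_congr_ae ?_
  filter_upwards [hf, hg] with x h₁ h₂
  rw [h₁, h₂, real_inner_eq_re_inner]
  simp [mul_comm]

/-- Green's formula: `⟨f, (a g')'⟩ = -⟨√a f', √a g'⟩`. -/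
theorem MemH2.exists_green {a : ℝ → ℝ} (ha : ∀ x ∈ Ioo (0 : ℝ) 1, 0 ≤ a x) {g h : L2} {w : ℝ → ℝ}
    (hg : MemH2 a g w h) : ∃ p : L2, MemH1 a g p ∧
      ∀ f q : L2, MemH1 a f q → inner ℝ f h = -inner ℝ q p := by
  obtain ⟨G, hG, hgG, hw, hwG, hw0, hh⟩ := hg
  have hp := hG.memLp_deriv.coeFn_toLp
  refine ⟨hG.memLp_deriv.toLp, ⟨G, hG, hgG, hp⟩, ?_⟩
  rintro f q ⟨F, hF, hfF, hq⟩
  rw [inner_eq_integral hfF hh, inner_eq_integral hq hp]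
  exact integral_mul_deriv_of_isH1 ha hF hG hw hwG hw0 ((Lp.memLp h).ae_eq hh)

/-! ### Energy of the time integral and uniqueness -/

theorem hasDerivAt_integral_of_continuousOn {E : Type*} [NormedAddCommGroup E] [NormedSpace ℝ E]
    [CompleteSpace E] {f : ℝ → E} {T : ℝ} (hf : ContinuousOn f (Icc 0 T)) {t : ℝ}
    (ht : t ∈ Ioo 0 T) : HasDerivAt (fun t => ∫ s in (0 : ℝ)..t, f s) (f t) t := by
  refine intervalIntegral.integral_hasDerivAt_right ?_ ?_
    (hf.continuousAt (Icc_mem_nhds ht.1 ht.2))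
  · refine ContinuousOn.intervalIntegrable ?_
    rw [uIcc_of_le ht.1.le]
    exact hf.mono (Icc_subset_Icc_right ht.2.le)
  · exact (hf.mono Ioo_subset_Icc_self).stronglyMeasurableAtFilter isOpen_Ioo t ht

theorem continuousOn_integral_of_continuousOn {E : Type*} [NormedAddCommGroup E]
    [NormedSpace ℝ E] {f : ℝ → E} {T : ℝ} (hT : 0 ≤ T) (hf : ContinuousOn f (Icc 0 T)) :
    ContinuousOn (fun t => ∫ s in (0 : ℝ)..t, f s) (Icc 0 T) := by
  have := intervalIntegral.continuousOn_primitive_interval (μ := volume) (f := f) (a := 0) (b := T)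
    (by rw [uIcc_of_le hT]; exact hf.integrableOn_Icc)
  rwa [uIcc_of_le hT] at this

/-- If `⟨Z(t), K(s)⟩` is symmetric, then `d/dt ⟨Z, K⟩ = 2 ⟨Z', K⟩`, even where `K` is only
continuous. -/
theorem hasDerivAt_inner_of_symm {E : Type*} [NormedAddCommGroup E] [InnerProductSpace ℝ E]
    {Z K : ℝ → E} {z : E} {T t : ℝ} (ht : t ∈ Ioo 0 T) (hZ : HasDerivAt Z z t)
    (hK : ContinuousAt K t)
    (hs : ∀ s ∈ Icc 0 T, ∀ r ∈ Icc 0 T, inner ℝ (Z s) (K r) = inner ℝ (Z r) (K s)) :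
    HasDerivAt (fun s => inner ℝ (Z s) (K s)) (2 * inner ℝ z (K t)) t := by
  rw [hasDerivAt_iff_tendsto_slope] at hZ ⊢
  -- By symmetry, `⟨Z(s),K(s)⟩ - ⟨Z(t),K(t)⟩ = ⟨Z(s) - Z(t), K(s) + K(t)⟩`, so only `Z` has to be
  -- differentiated.
  have h₁ : Tendsto (fun s => inner ℝ (slope Z t s) (K s + K t)) (𝓝[≠] t)
      (𝓝 (inner ℝ z (K t + K t))) :=
    hZ.inner ((hK.tendsto.mono_left nhdsWithin_le_nhds).add tendsto_const_nhds)
  have e : inner ℝ z (K t + K t) = 2 * inner ℝ z (K t) := by rw [inner_add_right]; ring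
  rw [e] at h₁
  refine h₁.congr' ?_
  filter_upwards [nhdsWithin_le_nhds (Icc_mem_nhds ht.1 ht.2)] with s hs'
  have := hs s hs' t (Ioo_subset_Icc_self ht)
  rw [slope_def_module, slope_def_module, real_inner_smul_left, smul_eq_mul]
  congr 1
  rw [inner_sub_left, inner_add_right, inner_add_right]
  linarith

/-- Mild solutions are too weak for their own energy identity, so the difference `u` is integrated
once in time. With `Z = ∫u` and `K = u'`, Green's formula gives `⟨Z(s), K(r)⟩ = -⟨P(s), P(r)⟩`,
where `P` is `√a Z_x`. This is symmetric, and `‖u‖² - ⟨Z, K⟩ = ‖u‖² + ‖P‖²` is the energy of `Z`,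
which is conserved and vanishes at time `0`. -/
theorem IsMildSolution.unique {a : ℝ → ℝ} (ha : ∀ x ∈ Ioo (0 : ℝ) 1, 0 ≤ a x) {T : ℝ} (hT : 0 < T)
    {U V U' V' : ℝ → L2} (h : IsMildSolution a T U V) (h' : IsMildSolution a T U' V')
    (hU : U 0 = U' 0) (hV : V 0 = V' 0) : ∀ t ∈ Icc 0 T, U t = U' t ∧ V t = V' t := by
  have green : ∀ {U V : ℝ → L2}, IsMildSolution a T U V → ∃ p : ℝ → L2, ∀ t ∈ Icc 0 T,
      MemH1 a (∫ s in (0 : ℝ)..t, U s) (p t) ∧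
        ∀ f q : L2, MemH1 a f q → inner ℝ f (V t - V 0) = -inner ℝ q (p t) := by
    intro U V h
    have : ∀ t, ∃ p : L2, t ∈ Icc 0 T → MemH1 a (∫ s in (0 : ℝ)..t, U s) p ∧
        ∀ f q : L2, MemH1 a f q → inner ℝ f (V t - V 0) = -inner ℝ q p := by
      intro t
      by_cases ht : t ∈ Icc 0 T
      · obtain ⟨w, hw⟩ := h.eq_snd t ht
        obtain ⟨p, hp⟩ := hw.exists_green ha
        exact ⟨p, fun _ => hp⟩
      · exact ⟨0, fun ht' => absurd ht' ht⟩
    choose p hp using this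
    exact ⟨p, hp⟩
  obtain ⟨p, hp⟩ := green h
  obtain ⟨p', hp'⟩ := green h'
  let u : ℝ → L2 := fun t => U t - U' t
  let K : ℝ → L2 := fun t => V t - V' t
  let Z : ℝ → L2 := fun t => (∫ s in (0 : ℝ)..t, U s) - ∫ s in (0 : ℝ)..t, U' s
  have hK : ∀ t, K t = (V t - V 0) - (V' t - V' 0) := fun t => by simp [K, hV]
  have hZK : ∀ s ∈ Icc 0 T, ∀ r ∈ Icc 0 T,
      inner ℝ (Z s) (K r) = -inner ℝ (p s - p' s) (p r - p' r) := by
    intro s hs r hr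
    rw [hK, inner_sub_right (Z s) (V r - V 0), inner_sub_left _ _ (V r - V 0),
      inner_sub_left _ _ (V' r - V' 0), (hp r hr).2 _ _ (hp s hs).1, (hp r hr).2 _ _ (hp' s hs).1,
      (hp' r hr).2 _ _ (hp s hs).1, (hp' r hr).2 _ _ (hp' s hs).1]
    simp only [inner_sub_left, inner_sub_right]
    ring
  have cu : ContinuousOn u (Icc 0 T) := h.continuousOn_fst.sub h'.continuousOn_fst
  have cK : ContinuousOn K (Icc 0 T) := h.continuousOn_snd.sub h'.continuousOn_snd
  have cZ : ContinuousOn Z (Icc 0 T) :=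
    (continuousOn_integral_of_continuousOn hT.le h.continuousOn_fst).sub
      (continuousOn_integral_of_continuousOn hT.le h'.continuousOn_fst)
  have dZ : ∀ t ∈ Ioo 0 T, HasDerivAt Z (u t) t := fun t ht =>
    (hasDerivAt_integral_of_continuousOn h.continuousOn_fst ht).sub
      (hasDerivAt_integral_of_continuousOn h'.continuousOn_fst ht)
  have du : ∀ t ∈ Ioo 0 T, HasDerivAt u (K t) t := by
    intro t ht
    refine ((hasDerivAt_integral_of_continuousOn h.continuousOn_snd ht).sub
      (hasDerivAt_integral_of_continuousOn h'.continuousOn_snd ht)).congr_of_eventuallyEq ?_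
    filter_upwards [Icc_mem_nhds ht.1 ht.2] with s hs
    simp only [u, h.eq_fst s hs, h'.eq_fst s hs, hU, Pi.sub_apply]
    abel
  have hpos : ∀ s ∈ Icc 0 T, inner ℝ (Z s) (K s) ≤ 0 := fun s hs => by
    rw [hZK s hs s hs]
    exact neg_nonpos.2 real_inner_self_nonneg
  have hzero := eq_zero_of_deriv_le_mul (C := 0)
    (e := fun t => inner ℝ (u t) (u t) - inner ℝ (Z t) (K t))
    (e' := fun t => (inner ℝ (u t) (K t) + inner ℝ (K t) (u t)) - 2 * inner ℝ (u t) (K t))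
    ((cu.inner cu).sub (cZ.inner cK))
    (fun t ht => ((du t ht).inner ℝ (du t ht)).sub (hasDerivAt_inner_of_symm ht (dZ t ht)
      (cK.continuousAt (Icc_mem_nhds ht.1 ht.2)) fun s hs r hr => by
        rw [hZK s hs r hr, hZK r hr s hs, real_inner_comm]))
    (fun t _ => by
      rw [real_inner_comm (u t) (K t)]
      linarith)
    (by simp [u, Z, hU])
    (fun t ht => by linarith [hpos t ht, real_inner_self_nonneg (x := u t)])
  have hu : ∀ t ∈ Icc 0 T, u t = 0 := fun t ht => by
    have h₁ := hzero t ht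
    have h₂ := hpos t ht
    have h₃ : inner ℝ (u t) (u t) ≤ 0 := by linarith
    exact inner_self_eq_zero.1 (le_antisymm h₃ real_inner_self_nonneg)
  have hK0 : ∀ t ∈ Ioo 0 T, K t = 0 := fun t ht => by
    refine (du t ht).unique ((hasDerivAt_const t (0 : L2)).congr_of_eventuallyEq ?_)
    filter_upwards [Icc_mem_nhds ht.1 ht.2] with s hs using hu s hs
  have hK' : EqOn K (fun _ => 0) (Icc 0 T) :=
    EqOn.of_subset_closure (s := Ioo 0 T) hK0 cK continuousOn_const Ioo_subset_Icc_self
      (by rw [closure_Ioo hT.ne])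
  exact fun t ht => ⟨sub_eq_zero.1 (hu t ht), sub_eq_zero.1 (hK' ht)⟩

/-! ### Classical solutions are mild solutions -/

/-- The continuous functions on `[0,1]` as elements of `L²(0,1)`. -/
theorem exists_toL2 : ∃ L : C(Icc (0 : ℝ) 1, ℝ) →L[ℝ] L2,
    ∀ f, L f =ᵐ[mu01] fun x => f (projIcc 0 1 zero_le_one x) := by
  let E : C(Icc (0 : ℝ) 1, ℝ) →ₗ[ℝ] BoundedContinuousFunction ℝ ℝ :=
    { toFun := fun f => (BoundedContinuousFunction.mkOfCompact f).compContinuous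
        ⟨projIcc 0 1 zero_le_one, continuous_projIcc⟩
      map_add' := fun f g => by ext; rfl
      map_smul' := fun c f => by ext; rfl }
  have hE : ∀ f, ‖E f‖ ≤ 1 * ‖f‖ := fun f => by
    rw [one_mul]
    exact (BoundedContinuousFunction.norm_le (norm_nonneg f)).2 fun x => f.norm_coe_le_norm _
  refine ⟨(BoundedContinuousFunction.toLp (p := 2) (μ := mu01) ℝ).comp (E.mkContinuous 1 hE),
    fun f => ?_⟩
  exact BoundedContinuousFunction.coeFn_toLp (p := 2) (μ := mu01) ℝ (E f)

/-- A continuous function of `(t,x)` is a continuous curve in `L²(0,1)`. -/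
theorem exists_L2_curve {g : ℝ → ℝ → ℝ} (hg : Continuous fun z : ℝ × ℝ => g z.1 z.2) :
    ∃ Γ : ℝ → L2, Continuous Γ ∧ (∀ t, Γ t =ᵐ[mu01] g t) ∧
      ∀ a b, (∫ s in a..b, Γ s : L2) =ᵐ[mu01] fun x => ∫ s in a..b, g s x := by
  obtain ⟨L, hL⟩ := exists_toL2
  let G : C(ℝ × Icc (0 : ℝ) 1, ℝ) :=
    ⟨fun z => g z.1 z.2, hg.comp (by fun_prop : Continuous fun z : ℝ × Icc (0 : ℝ) 1 =>
      (z.1, (z.2 : ℝ)))⟩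
  have hproj : ∀ᵐ x ∂mu01, (projIcc 0 1 zero_le_one x : ℝ) = x := by
    filter_upwards [ae_restrict_mem measurableSet_Ioo] with x hx
    rw [projIcc_of_mem _ (Ioo_subset_Icc_self hx)]
  -- As `[0,1]` is compact, currying turns joint continuity into continuity in time for the sup
  -- norm.
  have hc : Continuous fun t => G.curry t := G.curry.continuous
  refine ⟨fun t => L (G.curry t), L.continuous.comp hc, fun t => ?_, fun a b => ?_⟩
  · filter_upwards [hL (G.curry t), hproj] with x h₁ h₂
    rw [h₁]
    simp [G, h₂]
  · rw [L.intervalIntegral_comp_comm (hc.intervalIntegrable _ _)]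
    filter_upwards [hL (∫ s in a..b, G.curry s), hproj] with x h₁ h₂
    rw [h₁]
    have := (ContinuousMap.evalCLM ℝ (projIcc (0 : ℝ) 1 zero_le_one x) :
      C(Icc (0 : ℝ) 1, ℝ) →L[ℝ] ℝ).intervalIntegral_comp_comm
      (hc.intervalIntegrable (μ := volume) a b)
    simp only [ContinuousMap.evalCLM_apply, ContinuousMap.curry_apply] at this
    rw [← this]
    simp [G, h₂]

theorem memLp_of_continuous {f : ℝ → ℝ} (hf : Continuous f) : MemLp f 2 mu01 := by
  obtain ⟨C, hC⟩ := isCompact_Icc.exists_bound_of_continuousOn (s := Icc (0 : ℝ) 1) hf.continuousOn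
  refine MemLp.of_bound hf.aestronglyMeasurable C ?_
  filter_upwards [ae_restrict_mem measurableSet_Ioo] with x hx
  exact hC x (Ioo_subset_Icc_self hx)

theorem isH1_of_contDiff {a F : ℝ → ℝ} (ha : Continuous a) (hF : ContDiff ℝ 1 F) (h1 : F 1 = 0) :
    IsH1 a F where
  memLp := memLp_of_continuous hF.continuous
  locAC _ _ := hF.contDiffOn.absolutelyContinuousOnInterval
  memLp_deriv := memLp_of_continuous (ha.sqrt.mul (hF.continuous_deriv le_rfl))
  dirichlet := h1

/-- The flux of the time integral is `w = ∫₀ᵗ a u_x ds`; by the equation its derivative is `∫₀ᵗ u_tt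
ds = u_t(t) - u_t(0)`. The condition `w(0) = 0` is automatic from `a 0 = 0`, because `u` is `C²`
across `x = 0`. -/
theorem exists_mildSolution_of_classical {a : ℝ → ℝ} {T : ℝ} {u : ℝ → ℝ → ℝ}
    (ha : ContDiff ℝ 1 a) (ha0 : a 0 = 0)
    (hu : ContDiff ℝ 2 fun z : ℝ × ℝ => u z.1 z.2) (hd : ∀ t ∈ Icc 0 T, u t 1 = 0)
    (hpde : ∀ t ∈ Ioo 0 T, ∀ x ∈ Ioo (0 : ℝ) 1,
      deriv (deriv fun s => u s x) t - deriv (fun z => a z * deriv (u t) z) x = 0) :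
    ∃ U V : ℝ → L2, IsMildSolution a T U V ∧ (∀ t, U t =ᵐ[mu01] u t) ∧
      (∀ t, V t =ᵐ[mu01] fun x => deriv (fun s => u s x) t) ∧
      ∀ t ∈ Icc 0 T, ∃ w : ℝ → ℝ, MemH2 a (∫ s in (0 : ℝ)..t, U s) w (V t - V 0) ∧
        w 1 = a 1 * ∫ s in (0 : ℝ)..t, deriv (u s) 1 := by
  obtain ⟨ut, ux, dt, dx, ct, cx⟩ := exists_partials (n := 1) hu
  obtain ⟨utt, -, dtt, -, ctt, -⟩ := exists_partials (n := 0) ct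
  let b : ℝ → ℝ → ℝ := fun s x => a x * ux s x
  have cb : ContDiff ℝ (1 : ℕ) fun z : ℝ × ℝ => b z.1 z.2 := (ha.comp contDiff_snd).mul cx
  obtain ⟨-, bx, -, dbx, -, cbx⟩ := exists_partials (n := 0) cb
  have eut : ∀ x, (deriv fun s => u s x) = fun s => ut s x := fun x => funext fun s => (dt s x).deriv
  have eux : ∀ t, deriv (u t) = ux t := fun t => funext fun x => (dx t x).deriv
  have hpde' : ∀ t ∈ Ioo 0 T, ∀ x ∈ Ioo (0 : ℝ) 1, bx t x = utt t x := by
    intro t ht x hx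
    have := hpde t ht x hx
    rw [eut, eux, (dtt t x).deriv, (dbx t x).deriv] at this
    linarith
  have int_left : ∀ {g : ℝ → ℝ → ℝ}, Continuous (fun z : ℝ × ℝ => g z.1 z.2) → ∀ x c d,
      IntervalIntegrable (fun s => g s x) volume c d := fun hg x c d =>
    (continuous_uncurry_left hg x).intervalIntegrable c d
  obtain ⟨U, cU, hU, hUi⟩ := exists_L2_curve hu.continuous
  obtain ⟨V, cV, hV, hVi⟩ := exists_L2_curve ct.continuous
  obtain ⟨p, cp, hp, -⟩ := exists_L2_curve (g := fun t x => √(a x) * ux t x)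
    ((ha.continuous.comp continuous_snd).sqrt.mul cx.continuous)
  have hH2 : ∀ t ∈ Icc 0 T, ∃ w : ℝ → ℝ, MemH2 a (∫ s in (0 : ℝ)..t, U s) w (V t - V 0) ∧
      w 1 = a 1 * ∫ s in (0 : ℝ)..t, deriv (u s) 1 := by
    intro t ht
    have dF : ∀ x, HasDerivAt (fun x => ∫ s in (0 : ℝ)..t, u s x) (∫ s in (0 : ℝ)..t, ux s x) x :=
      fun x => hasDerivAt_integral_param dx hu.continuous cx.continuous 0 t x
    have dw : ∀ x, HasDerivAt (fun x => ∫ s in (0 : ℝ)..t, b s x) (∫ s in (0 : ℝ)..t, bx s x) x :=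
      fun x => hasDerivAt_integral_param dbx cb.continuous cbx.continuous 0 t x
    have line : ContDiff ℝ (1 : ℕ) fun x : ℝ => (t, x) := contDiff_const.prodMk contDiff_id
    have hF : ContDiff ℝ (1 : ℕ) fun x => ∫ s in (0 : ℝ)..t, u s x :=
      (contDiff_integral_param 1 (hu.of_le (by norm_num))).comp line
    have hw : ContDiff ℝ (1 : ℕ) fun x => ∫ s in (0 : ℝ)..t, b s x :=
      (contDiff_integral_param 1 cb).comp line
    have hwF : ∀ x, ∫ s in (0 : ℝ)..t, b s x = a x * ∫ s in (0 : ℝ)..t, ux s x := fun x =>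
      intervalIntegral.integral_const_mul _ _
    refine ⟨fun x => ∫ s in (0 : ℝ)..t, b s x, ⟨fun x => ∫ s in (0 : ℝ)..t, u s x,
      isH1_of_contDiff ha.continuous hF ?_, hUi 0 t, hw.contDiffOn.absolutelyContinuousOnInterval,
      Eventually.of_forall fun x => ?_, ?_, ?_⟩, ?_⟩
    · have e : EqOn (fun s => u s 1) (fun _ => 0) (uIcc 0 t) := fun s hs => by
        rw [uIcc_of_le ht.1] at hs
        exact hd s ⟨hs.1, hs.2.trans ht.2⟩
      rw [intervalIntegral.integral_congr e, intervalIntegral.integral_zero]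
    · beta_reduce
      rw [(dF x).deriv]
      exact hwF x
    · simp [hwF, ha0]
    · filter_upwards [Lp.coeFn_sub (V t) (V 0), hV t, hV 0, ae_restrict_mem measurableSet_Ioo]
        with x h₁ h₂ h₃ hx
      rw [h₁, Pi.sub_apply, h₂, h₃, (dw x).deriv,
        ← intervalIntegral.integral_eq_sub_of_hasDerivAt (fun s _ => dtt s x)
          (int_left ctt.continuous x 0 t)]
      refine intervalIntegral.integral_congr_ae ?_
      -- The equation is only known for `0 < s < T`, so the endpoint `s = T` is discarded as a null
      -- set.
      filter_upwards [compl_mem_ae_iff.2 (measure_singleton T)] with s hs hst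
      rw [uIoc_of_le ht.1] at hst
      exact (hpde' s ⟨hst.1, lt_of_le_of_ne (hst.2.trans ht.2) hs⟩ x hx).symm
    · simp only [hwF, eux]
  refine ⟨U, V, ⟨cU.continuousOn, cV.continuousOn, ⟨p, cp.continuousOn, fun t ht => ?_⟩,
    fun t ht => ?_, fun t ht => (hH2 t ht).imp fun w hw => hw.1⟩, hU, fun t => ?_, hH2⟩
  · have line : ContDiff ℝ 1 fun x : ℝ => (t, x) := contDiff_const.prodMk contDiff_id
    refine ⟨u t, isH1_of_contDiff ha.continuous ((hu.of_le (by norm_num)).comp line) (hd t ht),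
      hU t, ?_⟩
    rw [eux]
    exact hp t
  · refine Lp.ext ?_
    filter_upwards [Lp.coeFn_add (U 0) (∫ s in (0 : ℝ)..t, V s), hU t, hU 0, hVi 0 t]
      with x h₁ h₂ h₃ h₄
    rw [h₁, Pi.add_apply, h₂, h₃, h₄,
      intervalIntegral.integral_eq_sub_of_hasDerivAt (fun s _ => dt s x)
        (int_left ct.continuous x 0 t)]
    ring
  · simp only [eut]
    exact hV t

/-! ### Classical solutions with data supported far from `x = 1` -/

/-- Near `y = 0` the potential can be replaced by a globally smooth and bounded one. -/
theorem exists_extended_potential {θ ε : ℝ} (hθ : 2 ≤ θ) (hε : 0 < ε) :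
    ∃ Q : ℝ → ℝ, ContDiff ℝ 2 Q ∧ (∃ M, ∀ y, |Q y| ≤ M) ∧ ∀ y, ε ≤ y → Q y = potential θ y := by
  -- `m` is nonnegative and equals `y` for `y ≥ ε`; composing with it keeps the denominator of the
  -- potential at least `2`.
  let m : ℝ → ℝ := fun y => y * Real.smoothTransition (y / ε)
  have hm : ∀ y, 0 ≤ m y := fun y => by
    rcases le_total y 0 with h | h
    · simp [m, Real.smoothTransition.zero_of_nonpos (div_nonpos_of_nonpos_of_nonneg h hε.le)]
    · exact mul_nonneg h (Real.smoothTransition.nonneg _)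
  have cm : ContDiff ℝ 2 m :=
    contDiff_id.mul (Real.smoothTransition.contDiff.comp (contDiff_id.div_const ε))
  obtain ⟨M, hM⟩ := exists_abs_potential_le hθ
  refine ⟨fun y => potential θ (m y), ?_, ⟨M, fun y => hM _ (hm y)⟩, fun y hy => ?_⟩
  · refine contDiff_const.div ((contDiff_const.add (contDiff_const.mul cm)).pow 2) fun y => ?_
    have := mul_nonneg (sub_nonneg.2 hθ) (hm y)
    positivity
  · simp [m, Real.smoothTransition.one_of_one_le ((one_le_div hε).2 hy)]

/-- The transformed datum, extended by zero to the line, is smooth. -/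
theorem contDiff_transformData_extension {θ c d : ℝ} (hθ : 2 ≤ θ) {f : ℝ → ℝ}
    (hf : ContDiff ℝ ∞ f) (hc : 0 < c) (hcd : c ≤ d) (hd : 0 < phi θ d)
    (h : ∀ x, x ∉ Icc c d → f x = 0) :
    ContDiff ℝ 2 (fun y => if 0 < y then transformData θ f y else 0) ∧
      ∀ y, y ∉ Icc (phi θ d) (phi θ c) → (if 0 < y then transformData θ f y else 0) = 0 := by
  have hz : ∀ y, y ∉ Icc (phi θ d) (phi θ c) →
      (if 0 < y then transformData θ f y else 0) = 0 := by
    intro y hy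
    split_ifs with h0
    · exact transformData_eq_zero hc hcd h (mem_psiDomain hθ h0.le) hy
    · rfl
  refine ⟨contDiff_iff_contDiffAt.2 fun y => ?_, hz⟩
  rcases lt_or_ge 0 y with hy | hy
  · refine ContDiffAt.congr_of_eventuallyEq (f := transformData θ f) ?_ ?_
    · exact ((contDiffOn_transformData hf).contDiffAt
        ((isOpen_psiDomain θ).mem_nhds (mem_psiDomain hθ hy.le))).of_le ENat.LEInfty.out
    · filter_upwards [Ioi_mem_nhds hy] with z hz
      exact if_pos hz
  · refine ContDiffAt.congr_of_eventuallyEq (f := fun _ => (0 : ℝ)) contDiffAt_const ?_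
    filter_upwards [Iio_mem_nhds (hy.trans_lt hd)] with z hz'
    exact hz z fun hm => (not_lt.2 hm.1) hz'

/-- Up to time `T` the solution on the line vanishes for `y < A - T`. There the boundary condition
holds by itself, and changing the potential has no effect. -/
theorem exists_solutionW {θ T A B : ℝ} (hθ : 2 ≤ θ) (hA : T < A) {w₀ w₁ v₀ v₁ : ℝ → ℝ}
    (h₀ : ContDiff ℝ 2 v₀) (h₁ : ContDiff ℝ 2 v₁)
    (hz : ∀ y, y ∉ Icc A B → v₀ y = 0 ∧ v₁ y = 0)
    (hw : ∀ y ∈ Ioi (0 : ℝ), v₀ y = w₀ y ∧ v₁ y = w₁ y) :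
    ∃ v : ℝ → ℝ → ℝ, (ContDiff ℝ 2 fun z : ℝ × ℝ => v z.1 z.2) ∧ IsSolutionW θ T w₀ w₁ v ∧
      ∀ t y, B < y - |t| → v t y = 0 := by
  obtain ⟨Q, hQ, ⟨M, hM⟩, hQp⟩ := exists_extended_potential hθ (sub_pos.2 hA)
  obtain ⟨v, cv, hpde, hi, hi', hsupp⟩ := exists_wave_solution hQ hM h₀ h₁ hz
  refine ⟨v, cv, ⟨cv.contDiffOn, fun t ht y hy => ?_, fun t ht => ?_, fun y hy => ?_,
    fun y hy => ?_⟩, fun t y h => hsupp t y (Or.inr h)⟩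
  · have := hpde t y
    rcases le_or_gt (A - T) y with h | h
    · rwa [hQp y h] at this
    · rw [hsupp t y (Or.inl (by rw [abs_of_pos ht.1]; linarith [ht.2]))] at this ⊢
      rwa [mul_zero] at this ⊢
  · exact hsupp t 0 (Or.inl (by rw [abs_of_pos ht.1]; linarith [ht.2]))
  · rw [hi y, (hw y hy).1]
  · rw [← (hw y hy).2]
    exact (hi' y).hasDerivWithinAt

/-- The transformed solution also vanishes for `y > B + |t|`, so `u` is zero near `x = 0`, locally
uniformly in time. This gives the Neumann condition and makes the extension by zero to `x ≤ 0` of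
class `C²` on the whole plane, as the passage to mild solutions requires. -/
theorem exists_classical_solution {θ T : ℝ} (hθ : 2 ≤ θ) (hT : 0 < T) {u₀ u₁ : ℝ → ℝ}
    (h₀ : IsTestFunction (Ioo 0 (psi θ T)) u₀) (h₁ : IsTestFunction (Ioo 0 (psi θ T)) u₁) :
    ∃ u : ℝ → ℝ → ℝ, (ContDiff ℝ 2 fun z : ℝ × ℝ => u z.1 z.2) ∧ IsSolutionDW θ T u₀ u₁ u ∧
      (∀ t ∈ Icc 0 T, u t 1 = 0) ∧ ∀ t ∈ Icc 0 T, HasDerivWithinAt (u t) 0 (Iic 1) 1 := by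
  have hTd := mem_psiDomain hθ hT.le
  have hψ := psi_pos hTd
  obtain ⟨c₀, d₀, hc₀, hcd₀, hd₀, hz₀⟩ := h₀.exists_Icc hψ
  obtain ⟨c₁, d₁, hc₁, hcd₁, hd₁, hz₁⟩ := h₁.exists_Icc hψ
  set c := min c₀ c₁ with hc
  set d := max d₀ d₁ with hd
  have hc0 : 0 < c := lt_min hc₀ hc₁
  have hcd : c ≤ d := (min_le_left _ _).trans (hcd₀.trans (le_max_left _ _))
  have hz₀' : ∀ x, x ∉ Icc c d → u₀ x = 0 := fun x hx => hz₀ x fun h =>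
    hx (Icc_subset_Icc (min_le_left _ _) (le_max_left _ _) h)
  have hz₁' : ∀ x, x ∉ Icc c d → u₁ x = 0 := fun x hx => hz₁ x fun h =>
    hx (Icc_subset_Icc (min_le_right _ _) (le_max_right _ _) h)
  set A := phi θ d with hA
  set B := phi θ c with hB
  -- The support hypothesis in travel time: `d < ψ(T)` means that the data start beyond `y = T`.
  have hTA : T < A := (lt_psi_iff (hc0.trans_le hcd) hTd).1 (max_lt hd₀ hd₁)
  have hAB : A ≤ B := (strictAntiOn_phi θ).antitoneOn hc0 (hc0.trans_le hcd) hcd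
  have hA0 : 0 < A := hT.trans hTA
  have hB0 : 0 ≤ B := hA0.le.trans hAB
  obtain ⟨s₀, k₀⟩ := contDiff_transformData_extension hθ h₀.1 hc0 hcd hA0 hz₀'
  obtain ⟨s₁, k₁⟩ := contDiff_transformData_extension hθ h₁.1 hc0 hcd hA0 hz₁'
  obtain ⟨v, cv, hv, hfar⟩ := exists_solutionW (w₀ := transformData θ u₀)
    (w₁ := transformData θ u₁) hθ hTA s₀ s₁ (fun y hy => ⟨k₀ y hy, k₁ y hy⟩)
    (fun y hy => ⟨if_pos hy, if_pos hy⟩)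
  let u : ℝ → ℝ → ℝ := fun t x => if 0 < x then 1 / x ^ (θ / 4) * v t (phi θ x) else 0
  have huv : ∀ t ∈ Icc 0 T, ∀ x ∈ Ioc (0 : ℝ) 1, u t x = 1 / x ^ (θ / 4) * v t (phi θ x) :=
    fun t _ x hx => if_pos hx.1
  have hR : ∀ {R}, 0 ≤ R → 0 < psi θ R := fun hR => psi_pos (mem_psiDomain hθ hR)
  have hnear : ∀ R t x, 0 ≤ R → |t| ≤ R → x < psi θ (B + R) → u t x = 0 := by
    intro R t x hR0 ht hx
    by_cases h0 : 0 < x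
    · have := (lt_psi_iff h0 (mem_psiDomain hθ (by linarith))).1 hx
      simp only [u, if_pos h0]
      rw [hfar t _ (by linarith), mul_zero]
    · exact if_neg h0
  have cu : ContDiff ℝ 2 fun z : ℝ × ℝ => u z.1 z.2 := by
    refine contDiff_iff_contDiffAt.2 fun z => ?_
    rcases lt_or_ge 0 z.2 with hz | hz
    · refine ContDiffAt.congr_of_eventuallyEq
        (f := fun z : ℝ × ℝ => 1 / z.2 ^ (θ / 4) * v z.1 (phi θ z.2)) ?_ ?_
      · refine ContDiffAt.mul ?_ ?_
        · exact contDiffAt_const.div ((Real.contDiffAt_rpow_const_of_ne hz.ne').comp z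
            contDiffAt_snd) (Real.rpow_pos_of_pos hz _).ne'
        · have hφ : ContDiffAt ℝ 2 (phi θ) z.2 :=
            ((contDiffOn_phi θ).contDiffAt (Ioi_mem_nhds hz)).of_le ENat.LEInfty.out
          exact cv.contDiffAt.comp z (contDiffAt_fst.prodMk (hφ.comp z contDiffAt_snd))
      · filter_upwards [continuous_snd.continuousAt.eventually (Ioi_mem_nhds hz)] with w hw
        exact if_pos hw
    · refine ContDiffAt.congr_of_eventuallyEq (f := fun _ => (0 : ℝ)) contDiffAt_const ?_
      have e₁ : ∀ᶠ w : ℝ × ℝ in 𝓝 z, |w.1| < |z.1| + 1 :=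
        (by fun_prop : Continuous fun w : ℝ × ℝ => |w.1|).continuousAt.eventually_lt_const
          (lt_add_one _)
      have e₂ : ∀ᶠ w : ℝ × ℝ in 𝓝 z, w.2 < psi θ (B + (|z.1| + 1)) :=
        continuous_snd.continuousAt.eventually_lt_const (hz.trans_lt (hR (add_nonneg hB0 (by positivity))))
      filter_upwards [e₁, e₂] with w h₁ h₂
      exact hnear _ _ _ (by positivity) h₁.le h₂
  have hneumann : ∀ t ∈ Ioo 0 T, Tendsto (fun x => x ^ θ * deriv (u t) x) (𝓝[>] 0) (𝓝 0) := by
    intro t ht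
    refine tendsto_const_nhds.congr' ?_
    filter_upwards [nhdsWithin_le_nhds (Iio_mem_nhds (hR (R := B + T) (add_nonneg hB0 hT.le)))] with x hx
    have : u t =ᶠ[𝓝 x] fun _ => 0 := by
      filter_upwards [Iio_mem_nhds (show x < _ from hx)] with r hr
      exact hnear T t r hT.le (by rw [abs_of_pos ht.1]; exact ht.2.le) hr
    rw [this.deriv_eq, deriv_const, mul_zero]
  have hu1 : ∀ t ∈ Icc 0 T, u t 1 = 0 := fun t ht => by
    rw [huv t ht 1 ⟨one_pos, le_rfl⟩, phi_one, hv.dirichlet_Icc hT t ht, mul_zero]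
  refine ⟨u, cu, (liouville_iff hθ hT huv).2 ⟨hv, hneumann⟩, hu1, fun t ht => ?_⟩
  rw [liouville_normal_derivative hθ huv ht (hu1 t ht), neg_zero]
  refine hv.hasDerivWithinAt_zero hθ hT (fun z hz => ?_) t ht
  have hzI : z ∉ Icc A B := fun h => not_lt.2 (h.1.trans hz.2) hTA
  have hzd := mem_psiDomain hθ hz.1.le
  exact ⟨transformData_eq_zero hc0 hcd hz₀' hzd hzI, transformData_eq_zero hc0 hcd hz₁' hzd hzI⟩

/-! ### Data supported far from `x = 1` are not observed -/

theorem contDiff_rpow_of_two_le {θ : ℝ} (hθ : 2 ≤ θ) : ContDiff ℝ 1 fun x : ℝ => x ^ θ :=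
  Real.contDiff_rpow_const_of_le (by push_cast; linarith)

/-- The normal derivative is computed for the mild solution built from `u`; uniqueness carries it
over to every mild solution with the same data. -/
theorem exists_unobserved_solution {θ T : ℝ} (hθ : 2 ≤ θ) (hT : 0 < T) {u₀ u₁ : ℝ → ℝ}
    (h₀ : IsTestFunction (Ioo 0 (psi θ T)) u₀) (h₁ : IsTestFunction (Ioo 0 (psi θ T)) u₁) :
    ∃ u : ℝ → ℝ → ℝ, IsSolutionDW θ T u₀ u₁ u ∧
      (∀ t ∈ Icc 0 T, HasDerivWithinAt (u t) 0 (Iic 1) 1) ∧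
      (∃ U V : ℝ → L2, IsMildSolution (fun x => x ^ θ) T U V ∧ HasInitialData U V u₀ u₁) ∧
      ∀ U V : ℝ → L2, IsMildSolution (fun x => x ^ θ) T U V → HasInitialData U V u₀ u₁ →
        (∀ t ∈ Icc 0 T, U t =ᵐ[mu01] u t) ∧
        IsNormalDerivative (fun x => x ^ θ) T U V (fun _ => 0) := by
  obtain ⟨u, cu, hu, hu1, hux⟩ := exists_classical_solution hθ hT h₀ h₁
  have h0T : (0 : ℝ) ∈ Icc 0 T := left_mem_Icc.2 hT.le
  obtain ⟨U, V, hUV, hU, hV, hH2⟩ := exists_mildSolution_of_classical (contDiff_rpow_of_two_le hθ)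
    (Real.zero_rpow (by linarith)) cu hu1 hu.pde
  have hdiff : ∀ {g : ℝ → ℝ × ℝ}, ContDiff ℝ 2 g →
      Differentiable ℝ fun s => u (g s).1 (g s).2 := fun hg =>
    (cu.comp hg).differentiable (by norm_num)
  have hinit : HasInitialData U V u₀ u₁ := by
    constructor
    · filter_upwards [hU 0, ae_restrict_mem measurableSet_Ioo] with x h hx
      rw [h, hu.init x hx]
    · filter_upwards [hV 0, ae_restrict_mem measurableSet_Ioo] with x h hx
      rw [h]
      exact (uniqueDiffOn_Icc hT 0 h0T).eq_deriv _
        (hdiff (contDiff_id.prodMk contDiff_const) 0).hasDerivAt.hasDerivWithinAt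
        (hu.init_deriv x hx)
  have hnormal : ∀ t ∈ Icc 0 T, deriv (u t) 1 = 0 := fun t ht =>
    (uniqueDiffOn_Iic (1 : ℝ) 1 self_mem_Iic).eq_deriv _
      (hdiff (contDiff_const.prodMk contDiff_id) 1).hasDerivAt.hasDerivWithinAt (hux t ht)
  refine ⟨u, hu, hux, ⟨U, V, hUV, hinit⟩, fun U' V' hUV' hinit' => ?_⟩
  have huniq := hUV'.unique (fun x hx => (Real.rpow_pos_of_pos hx.1 θ).le) hT hUV
    (Lp.ext (hinit'.1.trans hinit.1.symm)) (Lp.ext (hinit'.2.trans hinit.2.symm))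
  refine ⟨fun t ht => by rw [(huniq t ht).1]; exact hU t, by simp, fun t ht => ?_⟩
  obtain ⟨w, hw, hw1⟩ := hH2 t ht
  have e : ∫ s in (0 : ℝ)..t, U' s = ∫ s in (0 : ℝ)..t, U s := by
    refine intervalIntegral.integral_congr fun s hs => ?_
    rw [uIcc_of_le ht.1] at hs
    exact (huniq s ⟨hs.1, hs.2.trans ht.2⟩).1
  have e' : ∫ s in (0 : ℝ)..t, deriv (u s) 1 = ∫ s in (0 : ℝ)..t, (0 : ℝ) := by
    refine intervalIntegral.integral_congr fun s hs => ?_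
    rw [uIcc_of_le ht.1] at hs
    exact hnormal s ⟨hs.1, hs.2.trans ht.2⟩
  exact ⟨w, by rw [e, (huniq t ht).2, (huniq 0 h0T).2]; exact hw, by rw [hw1, e']⟩

theorem exists_nonzero_data {θ T : ℝ} (hθ : 2 ≤ θ) (hT : 0 < T) :
    ∃ u₀ u₁ : ℝ → ℝ, IsTestFunction (Ioo 0 (psi θ T)) u₀ ∧ IsTestFunction (Ioo 0 (psi θ T)) u₁ ∧
      psi θ T < 1 ∧ u₀ ≠ 0 ∧ u₁ ≠ 0 := by
  have hψ := psi_mem_Ioo hθ hT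
  obtain ⟨f, hf, hf1⟩ := isTestFunction_contDiffBump hψ.1
  have hf0 : f ≠ 0 := fun h => by simp [h] at hf1
  exact ⟨f, f, hf, hf, hψ.2, hf0, hf0⟩

theorem not_ae_eq_zero_of_continuous {f : ℝ → ℝ} (hf : Continuous f) {x : ℝ}
    (hx : x ∈ Ioo (0 : ℝ) 1) (hfx : f x ≠ 0) : ¬ f =ᵐ[mu01] 0 := fun h => by
  have := Measure.eqOn_open_of_ae_eq h isOpen_Ioo hf.continuousOn continuousOn_const hx
  exact hfx this

/-- With a bump `f` as position and velocity, a zero normal derivative would force zero initial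
energy. The velocity alone already contradicts this, since `f` is continuous and nonzero. -/
theorem not_observable {θ T : ℝ} (hθ : 2 ≤ θ) (hT : 0 < T) :
    ¬ Observable (fun x => x ^ θ) T := by
  rintro ⟨C, hC, hobs⟩
  have hψ := psi_mem_Ioo hθ hT
  obtain ⟨f, hf, hf1⟩ := isTestFunction_contDiffBump hψ.1
  obtain ⟨u, -, -, ⟨U, V, hUV, hinit⟩, hall⟩ := exists_unobserved_solution hθ hT hf hf
  obtain ⟨-, hnormal⟩ := hall U V hUV hinit
  obtain ⟨p, -, hp⟩ := hUV.continuousOn_H1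
  have h := hobs U V hUV (p 0) (hp 0 (left_mem_Icc.2 hT.le)) _ hnormal
  simp only [ne_eq, OfNat.ofNat_ne_zero, not_false_eq_true, zero_pow,
    intervalIntegral.integral_zero] at h
  have hV : V 0 = 0 := by
    rw [← norm_eq_zero, ← sq_eq_zero_iff]
    have := (mul_nonpos_iff_pos_imp_nonpos.1 h).1 hC
    linarith [sq_nonneg ‖V 0‖, sq_nonneg ‖p 0‖]
  have h0 : f =ᵐ[mu01] 0 := by
    refine hinit.2.symm.trans ?_
    rw [hV]
    exact Lp.coeFn_zero ℝ 2 mu01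
  exact not_ae_eq_zero_of_continuous hf.1.continuous (x := psi θ T / 2)
    ⟨by linarith [hψ.1], by linarith [hψ.1, hψ.2]⟩ (by rw [hf1]; exact one_ne_zero) h0

end DegenerateWave

/-! ### Assembly of the result -/

open DegenerateWave in
theorem mainTheorem5 (θ T : ℝ) (hθ : 2 ≤ θ) (hT : 0 < T) :
    -- the coefficient `x^θ` has degeneracy parameter `μ_a = θ`
    IsLUB ((fun x : ℝ => x * |deriv (fun z : ℝ => z ^ θ) x| / x ^ θ) '' Ioc 0 1) θ ∧
    -- the change of variables `φ`, its inverse `ψ`, and the boundedness of the potential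
    (∀ x ∈ Ioc (0 : ℝ) 1, phi θ x =
      if θ = 2 then Real.log (1 / x) else 2 * (x ^ (1 - θ / 2) - 1) / (θ - 2)) ∧
    BijOn (phi θ) (Ioc 0 1) (Ici 0) ∧ InvOn (psi θ) (phi θ) (Ioc 0 1) (Ici 0) ∧
    (∃ M : ℝ, ∀ y ∈ Ici (0 : ℝ), |potential θ y| ≤ M) ∧
    -- transformed test functions on `(0,1)` are test functions on `(0,∞)`
    (∀ f : ℝ → ℝ, IsTestFunction (Ioo 0 1) f →
      ContDiffOn ℝ ∞ (transformData θ f) (Ici 0) ∧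
      ∃ K : Set ℝ, IsCompact K ∧ K ⊆ Ioi 0 ∧ ∀ y ∈ Ici (0 : ℝ), y ∉ K → transformData θ f y = 0) ∧
    -- the Liouville transform exchanges the two problems and their normal derivatives
    (∀ (u₀ u₁ : ℝ → ℝ) (u v : ℝ → ℝ → ℝ),
      (∀ t ∈ Icc 0 T, ∀ x ∈ Ioc (0 : ℝ) 1, u t x = 1 / x ^ (θ / 4) * v t (phi θ x)) →
      (IsSolutionDW θ T u₀ u₁ u ↔
        IsSolutionW θ T (transformData θ u₀) (transformData θ u₁) v ∧
        ∀ t ∈ Ioo 0 T, Tendsto (fun x => x ^ θ * deriv (u t) x) (𝓝[>] 0) (𝓝 0)) ∧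
      ∀ t ∈ Icc 0 T, u t 1 = 0 → ∀ d : ℝ,
        (HasDerivWithinAt (u t) d (Iic 1) 1 ↔ HasDerivWithinAt (v t) (-d) (Ici 0) 0)) ∧
    -- finite speed of propagation on the half-line
    (∀ (v₀ v₁ : ℝ → ℝ) (v : ℝ → ℝ → ℝ), IsSolutionW θ T v₀ v₁ v →
      (∀ t ∈ Icc 0 T, ∀ y ∈ Ici (0 : ℝ),
        (∀ z ∈ Ioi (0 : ℝ), |z - y| ≤ t → v₀ z = 0 ∧ v₁ z = 0) → v t y = 0) ∧
      ((∀ z ∈ Ioc 0 T, v₀ z = 0 ∧ v₁ z = 0) →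
        ∀ t ∈ Icc 0 T, HasDerivWithinAt (v t) 0 (Ici 0) 0)) ∧
    -- data supported far from `x = 1`: existence, uniqueness and vanishing normal derivative
    (∀ u₀ u₁ : ℝ → ℝ, IsTestFunction (Ioo 0 (psi θ T)) u₀ → IsTestFunction (Ioo 0 (psi θ T)) u₁ →
      ∃ u : ℝ → ℝ → ℝ, IsSolutionDW θ T u₀ u₁ u ∧
        (∀ t ∈ Icc 0 T, HasDerivWithinAt (u t) 0 (Iic 1) 1) ∧
        (∃ U V : ℝ → L2, IsMildSolution (fun x => x ^ θ) T U V ∧ HasInitialData U V u₀ u₁) ∧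
        ∀ U V : ℝ → L2, IsMildSolution (fun x => x ^ θ) T U V → HasInitialData U V u₀ u₁ →
          (∀ t ∈ Icc 0 T, U t =ᵐ[mu01] u t) ∧
          IsNormalDerivative (fun x => x ^ θ) T U V (fun _ => 0)) ∧
    -- such data exist with both components nonzero
    (∃ u₀ u₁ : ℝ → ℝ, IsTestFunction (Ioo 0 (psi θ T)) u₀ ∧ IsTestFunction (Ioo 0 (psi θ T)) u₁ ∧
      psi θ T < 1 ∧ u₀ ≠ 0 ∧ u₁ ≠ 0) ∧
    -- failure of observability
    ¬ Observable (fun x => x ^ θ) T := by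
  refine ⟨isLUB_degeneracy hθ, fun x hx => phi_eq hx.1,
    (invOn_psi_phi hθ).bijOn (mapsTo_phi θ) (mapsTo_psi hθ), invOn_psi_phi hθ,
    exists_abs_potential_le hθ, fun f hf => transformData_isTestFunction hθ hf,
    fun u₀ u₁ u v h => ⟨liouville_iff hθ hT h, fun t ht hu d =>
      liouville_normal_derivative hθ h ht hu d⟩,
    fun v₀ v₁ v hv => ⟨fun t ht y hy hd => hv.eq_zero_of_data hθ hT ht hy hd,
      hv.hasDerivWithinAt_zero hθ hT⟩,
    fun u₀ u₁ h₀ h₁ => exists_unobserved_solution hθ hT h₀ h₁, exists_nonzero_data hθ hT,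
    not_observable hθ hT⟩
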